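/- **Setting.** Let $H$ be a real Hilbert space (inner product $\langle\cdot,\cdot\rangle$, norm $\|\cdot\|$) and $V$ a normed space with $D(A)\subset V\subset H$ (continuous injections), where $A$ is a closed operator in $H$ whose domain $D(A)$, with the graph norm, is densely and compactly embedded in $H$. Let $\Lambda\subset\mathbb R$, let $P_\lambda:V\to H$ $(\lambda\in\Lambda)$ be bounded linear operators depending continuously on $\lambda$ in operator norm, and put $L_\lambda=-A+P_\lambda$ with domain $D(A)$. Let $B:V\times V\to H$ be bilinear and continuous. Assume, for some $\lambda_c<\lambda^*$ such that $\Lambda$ is a neighborhood of $\lambda_c$ and $[\lambda_c,\lambda^*]\subset\Lambda$: * **(A1)** $L_\lambda$ is self-adjoint for every $\lambda\in\Lambda$. Let $(\beta_n(\lambda),\boldsymbol e_n(\lambda))_{n\ge1}$ be its eigenelements, where $\beta_1(\lambda)\ge\beta_2(\lambda)\ge\cdots$ are repeated according to multiplicity and $(\boldsymbol e_n(\lambda))_{n\geq 1}$ is an orthonormal basis of $H$. Write $B_{ij}^n=\langle B(\boldsymbol e_i,\boldsymbol e_j),\boldsymbol e_n\rangle$ and let $\Pi_{\mathfrak s}$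 be the orthogonal projection onto the closed span $H_{\mathfrak s}$ of $\{\boldsymbol e_n:n\ge2\}$. * **(A2)** For $\lambda\in\Lambda$, $\beta_1(\lambda)$ is $<0$, $=0$, $>0$ according to whether $\lambda<\lambda_c$, $\lambda=\lambda_c$, $\lambda>\lambda_c$; and $\beta_j(\lambda)<0$ for all $j\ge2$ and all $\lambda\in[\lambda_c,\lambda^*]$. * **(A3)** $\langle B(u,u),u\rangle=0$ for all $u\in V$, and there is $N\ge1$ such that, for all $\lambda\in[\lambda_c,\lambda^*]$, $B_{11}^n=0$ for all $n>N$ while $B_{11}^n\ne0$ for at least one $2\le n\le N$. Let $(W_t)_{t\in\mathbb R}$ be a standard two-sided real Brownian motion on a probability space $(\Omega,\mathbb P)$. For $\lambda\in[\lambda_c,\lambda^*]$ set $\epsilon=\beta_1(\lambda)$, $\sigma=\sqrt\epsilon$ and $$M_{11}^{n,\lambda}(t,\omega)=\int_{-\infty}^0 e^{(2\epsilon-\beta_n(\lambda))s+\sigma(W_{t+s}(\omega)-W_t(\omega))}\,\mathrm ds .$$ * **(P)** For every $\lambda\in[\lambda_c,\lambda^*]$, almost surely, $\sum_{n=2}^N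 B_{11}^nM_{11}^{n,\lambda}(t)\,(B_{1n}^1+B_{n1}^1)<0$ for all $t\in\mathbb R$. With $\mathcal F_{\mathfrak c}(v)=\langle B(\boldsymbol e_1,v)+B(v,\boldsymbol e_1),\boldsymbol e_1\rangle$, consider for $t\ge 0$ the surrogate system, with unknowns $X(t)\in\mathbb R$ and $\Phi(t)\in V\cap H_{\mathfrak s}$, $$\mathrm dX=\big(\epsilon X+X\mathcal F_{\mathfrak c}(\Phi)\big)\mathrm dt+\sigma X\circ\mathrm dW_t,$$ $$\mathrm d\Phi=\big(\Pi_{\mathfrak s}L_\lambda\Phi+X^2\,\Pi_{\mathfrak s}B(\boldsymbol e_1,\boldsymbol e_1)+2\Phi\,\mathcal F_{\mathfrak c}(\Phi)\big)\mathrm dt+\sigma\Phi\circ\mathrm dW_t .$$ Here a solution of $\mathrm du=D\,\mathrm dt+\sigma u\circ\mathrm dW_t$ is a process $u$ for which, almost surely, $v=e^{-Z}u$ is continuous on $[0,\infty)$ and satisfies $\frac{\mathrm dv}{\mathrm dt}=Zv+e^{-Z}D$ on $(0,\infty)$ in the classical sense, where $Z(t)=-\sigma\int_{-\infty}^0e^{s}(W_{t+s}-W_t)\,\mathrm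 ds$ is the stationary solution of $\mathrm dr=-r\,\mathrm dt+\sigma\,\mathrm dW_t$; moreover, almost surely, $\Phi$ is continuous from $[0,\infty)$ to $V$ and $\Phi(t)\in D(A)$ for $t>0$. **Lemma 3.1.** Under these assumptions, let $c>0$, $T>0$ and $\chi\in(0,1)$. There exists $C>0$, independent of $\epsilon$ (that is, of $\lambda\in(\lambda_c,\lambda^*]$), such that for every $\lambda\in(\lambda_c,\lambda^*]$, with $\epsilon=\beta_1(\lambda)$ and $\sigma=\sqrt\epsilon$, for every $X_0\in\mathbb R$ with $|X_0|\le c\sqrt\epsilon$, and for every solution $(X,\Phi)$ of the surrogate system with, almost surely, $$X(0)=X_0,\qquad \Phi(0,\omega)=\sum_{n=2}^N B_{11}^n\,M_{11}^{n,\lambda}(0,\omega)\,X_0^2\,\boldsymbol e_n ,$$ one has $$\mathbb P\Big(\sup_{[0,T/\epsilon]}|X(t)|\le C\sqrt\epsilon\ \text{ and }\ \sup_{[0,T/\epsilon]}\|\Phi(t)\|\le C\epsilon\Big)\ge1-\chi .$$ -/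

import Mathlib

open MeasureTheory ProbabilityTheory Set Topology

noncomputable section

namespace SurrogateSPDE

/-! ## The linear operators `L_λ = -A + P_λ` -/

/-- The functional setting `D(A) ⊂ V ⊂ H` together with the family `P_λ : V → H`.
`A` is a closed operator whose domain is densely and compactly embedded in `H`; the inclusions
`D(A) ⊂ V ⊂ H` are the injective continuous linear maps `inc` and `emb`; the bounded operators
`P_λ : V → H` depend continuously (in operator norm) on the parameter `λ ∈ Λ`.
No sectoriality of `A` is needed, and `V` need not be a fractional power space of `A`. -/
structure LinearFamily (H V : Type*) [NormedAddCommGroup H] [InnerProductSpace ℝ H]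
    [NormedAddCommGroup V] [NormedSpace ℝ V] where
  /-- the parameter set -/
  Λ : Set ℝ
  /-- the operator `A`, with domain `A.domain = D(A) ⊂ H` -/
  A : H →ₗ.[ℝ] H
  dense_domain : Dense (A.domain : Set H)
  closed : A.IsClosed
  compact_domain : IsCompact (closure {x : H | ∃ u : A.domain, (u : H) = x ∧ ‖(u : H)‖ + ‖A u‖ ≤ 1})
  /-- the inclusion `V ⊂ H` -/
  emb : V →L[ℝ] H
  emb_injective : Function.Injective emb
  /-- the inclusion `D(A) ⊂ V` -/
  inc : A.domain →ₗ[ℝ] V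
  emb_inc : ∀ u : A.domain, emb (inc u) = (u : H)
  inc_bound : ∃ K : ℝ, ∀ u : A.domain, ‖inc u‖ ≤ K * (‖(u : H)‖ + ‖A u‖)
  /-- the operators `P_λ` -/
  P : ℝ → V →L[ℝ] H
  continuousOn_P : ContinuousOn P Λ

section Operators

variable {H V : Type*} [NormedAddCommGroup H] [InnerProductSpace ℝ H]
  [NormedAddCommGroup V] [NormedSpace ℝ V]

/-- The operator `L_λ = -A + P_λ`, with domain `D(A)`. -/
def LinearFamily.L (S : LinearFamily H V) (lam : ℝ) : H →ₗ.[ℝ] H where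
  domain := S.A.domain
  toFun := -S.A.toFun + (S.P lam).toLinearMap ∘ₗ S.inc

/-- `(β_n, e_n)`, `n = 1, 2, …`, are the eigenelements of the operator `T`, the eigenvalues being
listed in decreasing order and repeated according to their multiplicity, the eigenvectors forming
an orthonormal basis of `H`. -/
structure IsEigenbasis (T : H →ₗ.[ℝ] H) (β : ℕ+ → ℝ) (e : ℕ+ → T.domain) : Prop where
  orthonormal : Orthonormal ℝ (fun n => (e n : H))
  complete : (Submodule.span ℝ (Set.range fun n => (e n : H))).topologicalClosure = ⊤
  eigen : ∀ n, T (e n) = β n • (e n : H)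
  antitone : Antitone β

/-- The value of an unbounded operator, extended by `0` outside of its domain (it is only used
at points of the domain). -/
def evalOp (T : H →ₗ.[ℝ] H) (x : H) : H :=
  open Classical in if h : x ∈ T.domain then T ⟨x, h⟩ else 0

/-! ## The three conditions on the linear and nonlinear parts -/

/-- Principle of exchange of stabilities for a simple real eigenvalue `β_1`, at `lamc`; the other
eigenvalues stay negative on `[lamc, lams]`. -/
structure ExchangeOfStabilities (Λ : Set ℝ) (lamc lams : ℝ) (β : ℝ → ℕ+ → ℝ) : Prop where
  nhds : Λ ∈ 𝓝 lamc
  lt : lamc < lams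
  subset : Icc lamc lams ⊆ Λ
  neg : ∀ lam ∈ Λ, lam < lamc → β lam 1 < 0
  zero : β lamc 1 = 0
  pos : ∀ lam ∈ Λ, lamc < lam → 0 < β lam 1
  stable : ∀ lam ∈ Icc lamc lams, ∀ j : ℕ+, 2 ≤ j → β lam j < 0

/-- The interaction coefficient `B_{ij}^n = ⟨B(e_i, e_j), e_n⟩`. -/
def coef (S : LinearFamily H V) (B : V →L[ℝ] V →L[ℝ] H) (e : ℕ+ → S.A.domain)
    (i j n : ℕ+) : ℝ :=
  inner ℝ (B (S.inc (e i)) (S.inc (e j))) (e n : H)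

/-- The nonlinearity conserves the energy, and `B(e_1, e_1)` has finitely many nonzero components,
one of which, at least, is along a stable mode. (That `B : V × V → H` is bilinear and continuous
is part of its type.) -/
structure NonlinearCondition (S : LinearFamily H V) (B : V →L[ℝ] V →L[ℝ] H)
    (lamc lams : ℝ) (e : ℝ → ℕ+ → S.A.domain) (N : ℕ+) : Prop where
  energy : ∀ u : V, inner ℝ (B u u) (S.emb u) = 0
  finite : ∀ lam ∈ Icc lamc lams, ∀ n : ℕ+, N < n → coef S B (e lam) 1 1 n = 0
  nonzero : ∀ lam ∈ Icc lamc lams, ∃ n ∈ Finset.Icc 2 N, coef S B (e lam) 1 1 n ≠ 0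

/-- `F_c(v) = ⟨B(e_1, v) + B(v, e_1), e_1⟩`. -/
def Fc (S : LinearFamily H V) (B : V →L[ℝ] V →L[ℝ] H) (e : ℕ+ → S.A.domain) (v : V) : ℝ :=
  inner ℝ (B (S.inc (e 1)) v + B v (S.inc (e 1))) (e 1 : H)

/-- The orthogonal projection `Π_s` onto the closed span `H_s` of the stable modes
`e_2, e_3, …`, that is, onto the orthogonal complement of `e_1`. -/
def projStable (e₁ : H) (x : H) : H := x - (inner ℝ x e₁ : ℝ) • e₁

end Operators

/-! ## The noise -/

section Noise

variable {Ω : Type*} [MeasurableSpace Ω]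

/-- A standard Brownian motion indexed by the whole real line: `(W_t)_{t ≥ 0}` and
`(W_{-t})_{t ≥ 0}` are independent standard Brownian motions. -/
structure IsTwoSidedBrownian (W : ℝ → Ω → ℝ) (μ : Measure Ω) : Prop where
  measurable : ∀ t, Measurable (W t)
  forward : IsBrownianReal (fun (t : NNReal) ω => W t ω) μ
  backward : IsBrownianReal (fun (t : NNReal) ω => W (-t) ω) μ
  indep : IndepFun (fun ω (t : NNReal) => W t ω) (fun ω (t : NNReal) => W (-t) ω) μ

/-- The stationary Ornstein-Uhlenbeck process, the stationary solution `∫_{-∞}^t σ e^{s-t} dW_s`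
of `dr = -r dt + σ dW_t`, in its pathwise form (after an integration by parts)
`Z(t, ω) = -σ ∫_{-∞}^0 e^s (W_{t+s}(ω) - W_t(ω)) ds`. -/
def OU (W : ℝ → Ω → ℝ) (σ t : ℝ) (ω : Ω) : ℝ :=
  -σ * ∫ s in Iic (0 : ℝ), Real.exp s * (W (t + s) ω - W t ω)

/-- The process `u` is, on `[0, ∞)`, a solution of the Stratonovich equation
`du = D dt + σ u ∘ dW_t`, where the drift `D` may itself be computed from `u`, in the following
sense: almost surely, `v = e^{-Z} u` is continuous on `[0, ∞)` and is, on `(0, ∞)`, a classical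
solution of the equation with random coefficients `dv/dt = Z v + e^{-Z} D`, where `Z` is the
Ornstein-Uhlenbeck process. (When `D = L u + F(u)`, the right-hand side is
`L v + Z v + e^{-Z} F(e^Z v)`.) -/
structure SolvesStratonovich {E : Type*} [NormedAddCommGroup E] [NormedSpace ℝ E]
    (μ : Measure Ω) (W : ℝ → Ω → ℝ) (σ : ℝ) (D u : ℝ → Ω → E) : Prop where
  measurable : ∀ t, 0 ≤ t → StronglyMeasurable (u t)
  continuousOn : ∀ᵐ ω ∂μ, ContinuousOn (fun t => Real.exp (-OU W σ t ω) • u t ω) (Ici 0)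
  deriv : ∀ᵐ ω ∂μ, ∀ t : ℝ, 0 < t →
    HasDerivAt (fun s => Real.exp (-OU W σ s ω) • u s ω)
      (OU W σ t ω • (Real.exp (-OU W σ t ω) • u t ω) + Real.exp (-OU W σ t ω) • D t ω) t

/-- The random coefficients `M_{11}^n(t, ω) = ∫_{-∞}^0 e^{(2ε - β_n) s + σ (W_{t+s} - W_t)} ds`,
where `ε = β_1`. -/
def M (W : ℝ → Ω → ℝ) (σ : ℝ) (β : ℕ+ → ℝ) (n : ℕ+) (t : ℝ) (ω : Ω) : ℝ :=
  ∫ s in Iic (0 : ℝ), Real.exp ((2 * β 1 - β n) * s + σ * (W (t + s) ω - W t ω))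

end Noise

/-! ## The parameterization, the dissipation condition, and the surrogate system -/

section Surrogate

variable {H V Ω : Type*} [NormedAddCommGroup H] [InnerProductSpace ℝ H]
  [NormedAddCommGroup V] [NormedSpace ℝ V] [MeasurableSpace Ω]

/-- The parameterization `Φ(X, t, ω) = ∑_{n=2}^N B_{11}^n M_{11}^n(t, ω) X² e_n`. -/
def param (S : LinearFamily H V) (B : V →L[ℝ] V →L[ℝ] H) (W : ℝ → Ω → ℝ) (σ : ℝ)
    (β : ℕ+ → ℝ) (e : ℕ+ → S.A.domain) (N : ℕ+) (X t : ℝ) (ω : Ω) : V :=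
  ∑ n ∈ Finset.Icc 2 N, (coef S B e 1 1 n * M W σ β n t ω * X ^ 2) • S.inc (e n)

/-- The dissipation condition: almost surely,
`∑_{n=2}^N B_{11}^n M_{11}^n(t) (B_{1n}^1 + B_{n1}^1) < 0` for all `t`. -/
def Dissipation (S : LinearFamily H V) (B : V →L[ℝ] V →L[ℝ] H) (μ : Measure Ω)
    (W : ℝ → Ω → ℝ) (σ : ℝ) (β : ℕ+ → ℝ) (e : ℕ+ → S.A.domain) (N : ℕ+) : Prop :=
  ∀ᵐ ω ∂μ, ∀ t : ℝ, ∑ n ∈ Finset.Icc 2 N,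
    coef S B e 1 1 n * M W σ β n t ω * (coef S B e 1 n 1 + coef S B e n 1 1) < 0

/-- `(X, Φ)` is a solution on `[0, ∞)` of the surrogate system
`dX = (ε X + X F_c(Φ)) dt + σ X ∘ dW_t`,
`dΦ = (Π_s L_λ Φ + X² Π_s B(e_1, e_1) + 2 Φ F_c(Φ)) dt + σ Φ ∘ dW_t`,
with `ε = β_1(λ)`; `Φ` takes its values in `V ∩ H_s`, is continuous in `V` on `[0, ∞)`,
and lies in `D(A)` for positive times. -/
structure SolvesSurrogate (S : LinearFamily H V) (B : V →L[ℝ] V →L[ℝ] H) (μ : Measure Ω)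
    (W : ℝ → Ω → ℝ) (σ lam : ℝ) (β : ℕ+ → ℝ) (e : ℕ+ → S.A.domain)
    (X : ℝ → Ω → ℝ) (Φ : ℝ → Ω → V) : Prop where
  stable : ∀ᵐ ω ∂μ, ∀ t : ℝ, 0 ≤ t → inner ℝ (S.emb (Φ t ω)) (e 1 : H) = 0
  continuousOn : ∀ᵐ ω ∂μ, ContinuousOn (fun t => Φ t ω) (Ici 0)
  mem_domain : ∀ᵐ ω ∂μ, ∀ t : ℝ, 0 < t → S.emb (Φ t ω) ∈ S.A.domain
  eq_X : SolvesStratonovich μ W σ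
    (fun t ω => β 1 * X t ω + X t ω * Fc S B e (Φ t ω)) X
  eq_Φ : SolvesStratonovich μ W σ
    (fun t ω => projStable (e 1 : H) (evalOp (S.L lam) (S.emb (Φ t ω)))
      + X t ω ^ 2 • projStable (e 1 : H) (B (S.inc (e 1)) (S.inc (e 1)))
      + (2 * Fc S B e (Φ t ω)) • S.emb (Φ t ω))
    (fun t ω => S.emb (Φ t ω))

end Surrogate

end SurrogateSPDE

end

noncomputable section

namespace SurrogateSPDE

open Filter

/-! ### Spectral theory of `L_λ`, uniformly in `λ` -/

section Spectral

variable {H V : Type*} [NormedAddCommGroup H] [InnerProductSpace ℝ H]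
  [NormedAddCommGroup V] [NormedSpace ℝ V]

/-! Write F = B(e_1, e_1). Energy conservation, polarized, gives F_c(v) = -⟨F, v⟩ (`Fc_eq`). Along a
solution, the deviation of the n-th component of Φ from B_11^n M_11^n X² satisfies, after
multiplication by e^{-σW}, a homogeneous linear equation with rate β_n + 2F_c(Φ). It vanishes at
time 0, hence always: the parameterizing manifold is exactly invariant (`inner_eq_mul_M_mul_sq`).
Since M_11^n ≥ 0, it follows that ⟨F, Φ⟩ ≥ 0, so the feedback of Φ on X is damping and |X(t)| ≤
|X_0| e^{εt + σW_t}, while ‖Φ‖ is at most X² ‖F‖ times a bound on the M_11^n (`pathwise_bound`).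

What remains is uniformity in ε. On [0, T/ε] the term εt is at most T, and √ε |W| is tight by
Brownian scaling (`exists_sup_bound`). The M_11^n are controlled by this maximum and an exponential
integral over the past, whose expectation is at most 1/δ, where -δ bounds β_2 from above
(`meas_integral_gt_le`). The gap δ and a bound on e_1 in V, hence on ‖F‖, are uniform in λ by a
min-max perturbation argument and compactness (`exists_critical_mode_bound`). -/

theorem LinearFamily.L_apply (S : LinearFamily H V) (lam : ℝ) (u : S.A.domain) :
    S.L lam u = -S.A u + S.P lam (S.inc u) := rfl

theorem LinearFamily.L_sub_L (S : LinearFamily H V) (lam mu : ℝ) (u : S.A.domain) :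
    S.L lam u - S.L mu u = (S.P lam - S.P mu) (S.inc u) := by
  rw [S.L_apply, S.L_apply, sub_apply]; abel

/-- The graph norm of `L_λ` controls the norm of `V`, by the closed graph theorem. -/
theorem LinearFamily.exists_inc_bound [CompleteSpace H] (S : LinearFamily H V) (lam : ℝ)
    (hL : (S.L lam).IsClosed) :
    ∃ K : ℝ, 0 < K ∧ ∀ u : S.A.domain, ‖S.inc u‖ ≤ K * (‖(u : H)‖ + ‖S.L lam u‖) := by
  set G := (S.L lam).graph
  have hG : IsClosed (G : Set (H × H)) := hL
  have : CompleteSpace G := hG.completeSpace_coe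
  have hdom : ∀ p : G, ((LinearMap.fst ℝ H H) ∘ₗ G.subtype) p ∈ S.A.domain := by
    rintro ⟨⟨x, y⟩, hp⟩
    obtain ⟨u, hu, -⟩ := (LinearPMap.mem_graph_iff _).1 hp
    have : (u : H) ∈ S.A.domain := u.2
    rw [hu] at this
    exact this
  -- `g` sends (u, L_λ u) to A u. The graph `G` is complete and A is closed, so the closed graph
  -- theorem applies to `g`.
  let g : G →ₗ[ℝ] H := S.A.toFun ∘ₗ
    (LinearMap.codRestrict S.A.domain ((LinearMap.fst ℝ H H) ∘ₗ G.subtype) hdom)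
  have hgA : ∀ p : G, ((p : H × H).1, g p) ∈ S.A.graph := by
    intro p
    exact (LinearPMap.mem_graph_iff _).2 ⟨⟨_, hdom p⟩, rfl, rfl⟩
  have hcont : Continuous g := by
    refine LinearMap.continuous_of_seq_closed_graph g fun u x y hu hy => ?_
    have h1 : Tendsto (fun n => ((u n : H × H).1, g (u n))) atTop (𝓝 ((x : H × H).1, y)) :=
      (((continuous_fst.comp continuous_subtype_val).tendsto x).comp hu).prodMk_nhds hy
    have h2 : ((x : H × H).1, y) ∈ S.A.graph :=
      S.closed.mem_of_tendsto h1 (Eventually.of_forall fun n => hgA (u n))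
    exact LinearPMap.mem_graph_snd_inj _ h2 (hgA x) rfl
  obtain ⟨K, hK⟩ := S.inc_bound
  set g' : G →L[ℝ] H := ⟨g, hcont⟩
  refine ⟨(|K| + 1) * (1 + ‖g'‖), by positivity, fun u => ?_⟩
  have hu : ((u : H), S.L lam u) ∈ G := LinearPMap.mem_graph (S.L lam) u
  have h1 : ‖S.A u‖ ≤ ‖g'‖ * (‖(u : H)‖ + ‖S.L lam u‖) := by
    have h2 : S.A u = g' ⟨_, hu⟩ := rfl
    rw [h2]
    refine (g'.le_opNorm _).trans ?_
    gcongr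
    change ‖((u : H), S.L lam u)‖ ≤ _
    rw [Prod.norm_def]
    exact max_le (le_add_of_nonneg_right (norm_nonneg _)) (le_add_of_nonneg_left (norm_nonneg _))
  calc ‖S.inc u‖ ≤ K * (‖(u : H)‖ + ‖S.A u‖) := hK u
    _ ≤ (|K| + 1) * ((‖(u : H)‖ + ‖S.L lam u‖) + ‖g'‖ * (‖(u : H)‖ + ‖S.L lam u‖)) := by
        have := le_abs_self K
        have := norm_nonneg (S.L lam u)
        gcongr <;> linarith
    _ = _ := by ring

/-- Near `λ₀`, the graph norms of the operators `L_λ` control the norm of `V` uniformly, and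
`L_λ - L_λ₀` is small with respect to the norm of `V`. -/
theorem LinearFamily.eventually_inc_bound [CompleteSpace H] (S : LinearFamily H V) {lam₀ : ℝ}
    (h₀ : lam₀ ∈ S.Λ) (hL : (S.L lam₀).IsClosed) :
    ∃ K : ℝ, 0 < K ∧ ∀ θ : ℝ, 0 < θ → ∀ᶠ lam in 𝓝[S.Λ] lam₀, ∀ u : S.A.domain,
      ‖S.L lam u - S.L lam₀ u‖ ≤ θ * ‖S.inc u‖ ∧
      ‖S.inc u‖ ≤ K * (‖(u : H)‖ + ‖S.L lam u‖) := by
  obtain ⟨K, hK, hb⟩ := S.exists_inc_bound lam₀ hL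
  refine ⟨2 * K, by positivity, fun θ hθ => ?_⟩
  -- The threshold 1/(2K) leaves half of ‖u‖_V on the right, to be absorbed on the left; hence the
  -- constant 2K.
  have hη : 0 < min θ (1 / (2 * K)) := lt_min hθ (by positivity)
  have hc : ∀ᶠ lam in 𝓝[S.Λ] lam₀, ‖S.P lam - S.P lam₀‖ < min θ (1 / (2 * K)) := by
    have := (S.continuousOn_P lam₀ h₀).eventually (Metric.ball_mem_nhds _ hη)
    filter_upwards [this] with lam hlam
    rwa [← dist_eq_norm]
  filter_upwards [hc] with lam hlam u
  have h1 : ‖S.L lam u - S.L lam₀ u‖ ≤ min θ (1 / (2 * K)) * ‖S.inc u‖ := by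
    rw [S.L_sub_L]
    exact (ContinuousLinearMap.le_opNorm _ _).trans (by gcongr)
  refine ⟨h1.trans (by gcongr; exact min_le_left _ _), ?_⟩
  have h2 : ‖S.L lam u - S.L lam₀ u‖ ≤ 1 / (2 * K) * ‖S.inc u‖ :=
    h1.trans (by gcongr; exact min_le_right _ _)
  have h3 : ‖S.L lam₀ u‖ ≤ ‖S.L lam u‖ + ‖S.L lam u - S.L lam₀ u‖ := by
    have := norm_sub_le (S.L lam u) (S.L lam u - S.L lam₀ u)
    rwa [sub_sub_cancel] at this
  have h4 : K * (1 / (2 * K) * ‖S.inc u‖) = ‖S.inc u‖ / 2 := by field_simp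
  have h5 := hb u
  have h6 : K * ‖S.L lam₀ u‖ ≤ K * ‖S.L lam u‖ + K * (1 / (2 * K) * ‖S.inc u‖) := by
    rw [← mul_add]; gcongr; linarith
  linarith

/-- The Hilbert basis of eigenvectors. -/
def IsEigenbasis.basis [CompleteSpace H] {T : H →ₗ.[ℝ] H} {β : ℕ+ → ℝ} {e : ℕ+ → T.domain}
    (h : IsEigenbasis T β e) : HilbertBasis ℕ+ ℝ H :=
  HilbertBasis.mk h.orthonormal h.complete.ge

theorem IsEigenbasis.basis_apply [CompleteSpace H] {T : H →ₗ.[ℝ] H} {β : ℕ+ → ℝ}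
    {e : ℕ+ → T.domain} (h : IsEigenbasis T β e) (n : ℕ+) : h.basis n = (e n : H) := by
  simp [IsEigenbasis.basis]

theorem _root_.IsSelfAdjoint.inner_apply_left [CompleteSpace H] {T : H →ₗ.[ℝ] H}
    (hT : IsSelfAdjoint T) (u v : T.domain) :
    inner ℝ (T u) (v : H) = inner ℝ (u : H) (T v) := by
  have h := LinearPMap.adjoint_isFormalAdjoint hT.dense_domain
  rw [LinearPMap.isSelfAdjoint_def.1 hT] at h
  exact h u v

theorem IsEigenbasis.inner_apply_eigenvector [CompleteSpace H] {T : H →ₗ.[ℝ] H} {β : ℕ+ → ℝ}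
    {e : ℕ+ → T.domain} (h : IsEigenbasis T β e) (hT : IsSelfAdjoint T) (u : T.domain) (n : ℕ+) :
    inner ℝ (T u) (e n : H) = β n * inner ℝ (u : H) (e n : H) := by
  rw [hT.inner_apply_left, h.eigen, inner_smul_right]

theorem IsEigenbasis.hasSum_inner [CompleteSpace H] {T : H →ₗ.[ℝ] H} {β : ℕ+ → ℝ}
    {e : ℕ+ → T.domain} (h : IsEigenbasis T β e) (x y : H) :
    HasSum (fun n => inner ℝ x (e n : H) * inner ℝ y (e n : H)) (inner ℝ x y) := by
  have := h.basis.hasSum_inner_mul_inner x y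
  simp only [h.basis_apply] at this
  simpa only [real_inner_comm y] using this

/-- Parseval, compared term by term. Only the modes present in `u` count, so `b` can be β_2 when `u`
is orthogonal to e_1. -/
theorem IsEigenbasis.inner_apply_self_le [CompleteSpace H] {T : H →ₗ.[ℝ] H} {β : ℕ+ → ℝ}
    {e : ℕ+ → T.domain} (h : IsEigenbasis T β e) (hT : IsSelfAdjoint T) (u : T.domain) (b : ℝ)
    (hb : ∀ n, inner ℝ (u : H) (e n : H) ≠ 0 → β n ≤ b) :
    inner ℝ (T u) (u : H) ≤ b * ‖(u : H)‖ ^ 2 := by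
  have h1 := h.hasSum_inner (T u) u
  have h2 := (h.hasSum_inner (u : H) u).mul_left b
  rw [real_inner_self_eq_norm_sq] at h2
  refine hasSum_le (fun n => ?_) h1 h2
  rw [h.inner_apply_eigenvector hT, mul_assoc]
  by_cases h0 : inner ℝ (u : H) (e n : H) = 0
  · simp [h0]
  · exact mul_le_mul_of_nonneg_right (hb n h0) (mul_self_nonneg _)

/-- The dimension count of the min-max principle: a plane always meets a hyperplane in a unit
vector. -/
theorem exists_unit_orthogonal (p q : ℝ) : ∃ x y : ℝ, x ^ 2 + y ^ 2 = 1 ∧ x * p + y * q = 0 := by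
  by_cases h : p ^ 2 + q ^ 2 = 0
  · have hp : p = 0 := by nlinarith [sq_nonneg p, sq_nonneg q]
    have hq : q = 0 := by nlinarith [sq_nonneg p, sq_nonneg q]
    exact ⟨1, 0, by simp, by simp [hp, hq]⟩
  · have h0 : 0 < p ^ 2 + q ^ 2 := by positivity
    have hs := Real.sq_sqrt h0.le
    have hs0 : Real.sqrt (p ^ 2 + q ^ 2) ≠ 0 := (Real.sqrt_pos.2 h0).ne'
    refine ⟨q / Real.sqrt (p ^ 2 + q ^ 2), -p / Real.sqrt (p ^ 2 + q ^ 2), ?_, ?_⟩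
    · rw [div_pow, div_pow, hs]; field_simp; ring
    · field_simp; ring

/-- Locally uniform control of the critical mode and of the spectral gap. -/
theorem eventually_critical_mode_bound [CompleteSpace H] (S : LinearFamily H V)
    (β : ℝ → ℕ+ → ℝ) (e : ℝ → ℕ+ → S.A.domain)
    (he : ∀ lam ∈ S.Λ, IsEigenbasis (S.L lam) (β lam) (e lam))
    (hA1 : ∀ lam ∈ S.Λ, IsSelfAdjoint (S.L lam)) {I : Set ℝ} (hI : I ⊆ S.Λ)
    (h1 : ∀ lam ∈ I, 0 ≤ β lam 1) (h2 : ∀ lam ∈ I, β lam 2 < 0) {lam₀ : ℝ} (h₀ : lam₀ ∈ I) :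
    ∃ K δ : ℝ, 0 < δ ∧ ∀ᶠ lam in 𝓝[I] lam₀, ‖S.inc (e lam 1)‖ ≤ K ∧ β lam 2 ≤ -δ := by
  obtain ⟨K, hK, hev⟩ := S.eventually_inc_bound (hI h₀) (hA1 _ (hI h₀)).isClosed
  set η := -β lam₀ 2 / 2 with hη
  have hη0 : 0 < η := by have := h2 _ h₀; linarith
  set K₁ := 2 * β lam₀ 1 + 1 with hK₁
  have hK₁0 : 0 < K₁ := by have := h1 _ h₀; linarith
  have hQ : 0 < K * (1 + K₁ + η) := by positivity
  -- The first bound lets β_1(λ) be absorbed in `hβK`; the second keeps the perturbation of the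
  -- quadratic form below η/2 on the test vector `u`.
  set θ := min (1 / (2 * K)) (η / (2 * (K * (1 + K₁ + η)))) with hθ
  have hθ0 : 0 < θ := lt_min (by positivity) (by positivity)
  have hθ1 : θ * K ≤ 1 / 2 := by
    calc θ * K ≤ 1 / (2 * K) * K := by gcongr; exact min_le_left _ _
      _ = 1 / 2 := by field_simp
  have hθ2 : θ * (K * (1 + K₁ + η)) ≤ η / 2 := by
    calc θ * (K * (1 + K₁ + η)) ≤ η / (2 * (K * (1 + K₁ + η))) * (K * (1 + K₁ + η)) := by
          gcongr; exact min_le_right _ _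
      _ = η / 2 := by field_simp
  refine ⟨K * (1 + K₁), η, hη0, ?_⟩
  filter_upwards [nhdsWithin_mono _ hI (hev θ hθ0), self_mem_nhdsWithin] with lam hlam hlamI
  have E := he _ (hI hlamI)
  have E₀ := he _ (hI h₀)
  have hT := hA1 _ (hI hlamI)
  have hT₀ := hA1 _ (hI h₀)
  have hβ1 := h1 _ hlamI
  have hn : ∀ n, ‖(e lam n : H)‖ = 1 := E.orthonormal.1
  have hLe : ∀ n, S.L lam (e lam n) = β lam n • (e lam n : H) := E.eigen
  have hV1 : ‖S.inc (e lam 1)‖ ≤ K * (1 + β lam 1) := by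
    have := (hlam (e lam 1)).2
    rwa [hLe, norm_smul, hn, mul_one, Real.norm_of_nonneg hβ1] at this
  have hdiff : ∀ u : S.A.domain, ‖(u : H)‖ = 1 →
      inner ℝ (S.L lam u) (u : H) ≤ inner ℝ (S.L lam₀ u) (u : H) + θ * ‖S.inc u‖ := by
    intro u hu
    have h3 := real_inner_le_norm (S.L lam u - S.L lam₀ u) (u : H)
    rw [inner_sub_left, hu, mul_one] at h3
    have := (hlam u).1
    linarith
  have hβK : β lam 1 ≤ K₁ := by
    have h3 := hdiff (e lam 1) (hn 1)
    rw [hLe, real_inner_smul_left, real_inner_self_eq_norm_sq, hn] at h3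
    have h4 := E₀.inner_apply_self_le hT₀ (e lam 1) (β lam₀ 1)
      (fun n _ => E₀.antitone (one_le))
    rw [show ‖((e lam 1 : S.A.domain) : H)‖ = 1 from hn 1] at h4
    have h5 : θ * ‖S.inc (e lam 1)‖ ≤ 1 / 2 * (1 + β lam 1) :=
      calc θ * ‖S.inc (e lam 1)‖ ≤ θ * (K * (1 + β lam 1)) := by gcongr
        _ = θ * K * (1 + β lam 1) := by ring
        _ ≤ _ := by gcongr
    linarith
  refine ⟨hV1.trans (by gcongr), ?_⟩
  -- If β_2(λ) > -η, a unit vector `u` in the span of e_1(λ), e_2(λ) orthogonal to e_1(λ₀) gives a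
  -- form of L_λ at least -η, yet at most β_2(λ₀) + η/2 = -3η/2. The same assumption bounds ‖L_λ u‖,
  -- hence `u` in V.
  by_contra hcon
  push Not at hcon
  have hβ2 := h2 _ hlamI
  obtain ⟨x, y, hxy, hort⟩ := exists_unit_orthogonal
    (inner ℝ (e lam 1 : H) (e lam₀ 1 : H)) (inner ℝ (e lam 2 : H) (e lam₀ 1 : H))
  set u : S.A.domain := x • e lam 1 + y • e lam 2 with hu
  have hucoe : (u : H) = x • (e lam 1 : H) + y • (e lam 2 : H) := by simp [hu]
  have hii : ∀ n, inner ℝ (e lam n : H) (e lam n : H) = (1 : ℝ) := fun n => by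
    rw [real_inner_self_eq_norm_sq, hn, one_pow]
  have h12 : inner ℝ (e lam 1 : H) (e lam 2 : H) = 0 := E.orthonormal.2 (by decide)
  have h21 : inner ℝ (e lam 2 : H) (e lam 1 : H) = 0 := E.orthonormal.2 (by decide)
  have hLu : S.L lam u = (x * β lam 1) • (e lam 1 : H) + (y * β lam 2) • (e lam 2 : H) := by
    have : S.L lam u = x • S.L lam (e lam 1) + y • S.L lam (e lam 2) := by
      rw [hu]
      exact ((S.L lam).map_add _ _).trans
        (congrArg₂ _ ((S.L lam).map_smul _ _) ((S.L lam).map_smul _ _))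
    rw [this, hLe, hLe, smul_smul, smul_smul]
  have hunorm : ‖(u : H)‖ = 1 := by
    have : ‖(u : H)‖ ^ 2 = 1 := by
      rw [← real_inner_self_eq_norm_sq, hucoe]
      simp only [inner_add_left, inner_add_right, real_inner_smul_left, real_inner_smul_right,
        h12, h21, hii]
      linarith
    nlinarith [norm_nonneg (u : H)]
  have hquad : inner ℝ (S.L lam u) (u : H) = x ^ 2 * β lam 1 + y ^ 2 * β lam 2 := by
    rw [hLu, hucoe]
    simp only [inner_add_left, inner_add_right, real_inner_smul_left, real_inner_smul_right,
      h12, h21, hii]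
    ring
  have hx1 : |x| ≤ 1 := abs_le_one_iff_mul_self_le_one.2 (by nlinarith [sq_nonneg y])
  have hy1 : |y| ≤ 1 := abs_le_one_iff_mul_self_le_one.2 (by nlinarith [sq_nonneg x])
  have hLunorm : ‖S.L lam u‖ ≤ K₁ + η := by
    rw [hLu]
    refine (norm_add_le _ _).trans ?_
    rw [norm_smul, norm_smul, hn, hn, mul_one, mul_one, Real.norm_eq_abs, Real.norm_eq_abs,
      abs_mul, abs_mul]
    have h3 : |β lam 1| ≤ K₁ := by rwa [abs_of_nonneg hβ1]
    have h4 : |β lam 2| ≤ η := by rw [abs_of_neg hβ2]; linarith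
    have h5 : |x| * |β lam 1| ≤ 1 * K₁ := by gcongr
    have h6 : |y| * |β lam 2| ≤ 1 * η := by gcongr
    linarith
  have hV : θ * ‖S.inc u‖ ≤ η / 2 := by
    have := (hlam u).2
    rw [hunorm] at this
    calc θ * ‖S.inc u‖ ≤ θ * (K * (1 + K₁ + η)) := by
          gcongr; exact this.trans (by rw [add_assoc]; gcongr)
      _ ≤ _ := hθ2
  have h3 := hdiff u hunorm
  have h4 : inner ℝ (S.L lam₀ u) (u : H) ≤ β lam₀ 2 * ‖(u : H)‖ ^ 2 := by
    refine E₀.inner_apply_self_le hT₀ u _ fun n hne => E₀.antitone ?_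
    have hn1 : n ≠ 1 := by
      rintro rfl
      apply hne
      change inner ℝ (u : H) (e lam₀ 1 : H) = 0
      rw [hucoe, inner_add_left, real_inner_smul_left, real_inner_smul_left, hort]
    exact PNat.add_one_le_iff.2 (lt_of_le_of_ne (one_le) hn1.symm)
  rw [hunorm] at h4
  rw [hquad] at h3
  nlinarith [sq_nonneg x, sq_nonneg y, mul_nonneg (sq_nonneg x) hβ1]

/-- Uniform control of the critical mode and of the spectral gap on a compact set. -/
theorem exists_critical_mode_bound [CompleteSpace H] (S : LinearFamily H V)
    (β : ℝ → ℕ+ → ℝ) (e : ℝ → ℕ+ → S.A.domain)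
    (he : ∀ lam ∈ S.Λ, IsEigenbasis (S.L lam) (β lam) (e lam))
    (hA1 : ∀ lam ∈ S.Λ, IsSelfAdjoint (S.L lam)) {I : Set ℝ} (hIc : IsCompact I) (hI : I ⊆ S.Λ)
    (h1 : ∀ lam ∈ I, 0 ≤ β lam 1) (h2 : ∀ lam ∈ I, β lam 2 < 0) :
    ∃ K δ : ℝ, 0 < δ ∧ ∀ lam ∈ I, ‖S.inc (e lam 1)‖ ≤ K ∧ β lam 2 ≤ -δ := by
  refine hIc.induction_on
    (p := fun s => ∃ K δ : ℝ, 0 < δ ∧ ∀ lam ∈ s, ‖S.inc (e lam 1)‖ ≤ K ∧ β lam 2 ≤ -δ)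
    ⟨0, 1, one_pos, by simp⟩ ?_ ?_ ?_
  · rintro s t hst ⟨K, δ, hδ, h⟩
    exact ⟨K, δ, hδ, fun lam hl => h lam (hst hl)⟩
  · rintro s t ⟨K, δ, hδ, h⟩ ⟨K', δ', hδ', h'⟩
    refine ⟨max K K', min δ δ', lt_min hδ hδ', ?_⟩
    rintro lam (hl | hl)
    · exact ⟨(h lam hl).1.trans (le_max_left _ _),
        (h lam hl).2.trans (neg_le_neg (min_le_left _ _))⟩
    · exact ⟨(h' lam hl).1.trans (le_max_right _ _),
        (h' lam hl).2.trans (neg_le_neg (min_le_right _ _))⟩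
  · intro lam₀ h₀
    obtain ⟨K, δ, hδ, hev⟩ := eventually_critical_mode_bound S β e he hA1 hI h1 h2 h₀
    exact ⟨_, hev, K, δ, hδ, fun lam hl => hl⟩

end Spectral

/-! ### Probabilistic estimates on the Brownian path -/

section NoiseEstimates

variable {Ω : Type*} [MeasurableSpace Ω] {μ : Measure Ω} {W : ℝ → Ω → ℝ}

theorem IsTwoSidedBrownian.ae_continuous (hW : IsTwoSidedBrownian W μ) :
    ∀ᵐ ω ∂μ, Continuous (fun t => W t ω) := by
  filter_upwards [hW.forward.cont, hW.backward.cont] with ω hf hb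
  -- Truncation at 0 turns one of the two half-line terms into W_0, which is subtracted.
  have h : (fun t => W t ω) = fun t : ℝ =>
      W (t.toNNReal : ℝ) ω + W (-((-t).toNNReal : ℝ)) ω - W 0 ω := by
    funext t
    rcases le_total 0 t with ht | ht
    · rw [Real.toNNReal_of_nonpos (neg_nonpos.2 ht), Real.coe_toNNReal _ ht]; simp
    · rw [Real.toNNReal_of_nonpos ht, Real.coe_toNNReal _ (neg_nonneg.2 ht)]; simp
  rw [h]
  exact ((hf.comp continuous_real_toNNReal).add
    (hb.comp (continuous_real_toNNReal.comp continuous_neg))).sub continuous_const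

theorem IsTwoSidedBrownian.ae_zero (hW : IsTwoSidedBrownian W μ) : ∀ᵐ ω ∂μ, W 0 ω = 0 := by
  simpa using hW.forward.eval_zero_ae_eq_zero

theorem IsTwoSidedBrownian.lintegral_exp (hW : IsTwoSidedBrownian W μ) (κ : ℝ) {s : ℝ}
    (hs : s ≤ 0) :
    ∫⁻ ω, ENNReal.ofReal (Real.exp (κ * W s ω)) ∂μ = ENNReal.ofReal (Real.exp (-(κ ^ 2 / 2) * s)) := by
  have hlaw := hW.backward.hasLaw_eval (-s).toNNReal
  simp only [Real.coe_toNNReal _ (neg_nonneg.2 hs), neg_neg] at hlaw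
  have h1 := hlaw.lintegral_comp (f := fun x => ENNReal.ofReal (Real.exp (κ * x)))
    (by fun_prop)
  have h2 := ofReal_integral_eq_lintegral_ofReal
    (integrable_exp_mul_gaussianReal (μ := 0) (v := (-s).toNNReal) κ)
    (Eventually.of_forall fun x => (Real.exp_pos _).le)
  have h3 := congrFun (mgf_id_gaussianReal (μ := 0) (v := (-s).toNNReal)) κ
  rw [mgf] at h3
  rw [show (fun ω => ENNReal.ofReal (Real.exp (κ * W s ω)))
    = (fun x => ENNReal.ofReal (Real.exp (κ * x))) ∘ (W s) from rfl]
  refine h1.trans (h2.symm.trans ?_)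
  congr 1
  refine h3.trans ?_
  rw [Real.coe_toNNReal _ (neg_nonneg.2 hs)]
  congr 1; ring

/-- A jointly measurable modification of the Brownian motion. -/
theorem IsTwoSidedBrownian.exists_modification (hW : IsTwoSidedBrownian W μ) :
    ∃ W' : ℝ → Ω → ℝ, Measurable (Function.uncurry W') ∧ ∀ᵐ ω ∂μ, ∀ t, W' t ω = W t ω := by
  obtain ⟨G, hGμ, hGm, hG⟩ := hW.ae_continuous.exists_measurable_mem
  refine ⟨fun t => G.indicator (W t), ?_, ?_⟩
  · apply measurable_uncurry_of_continuous_of_measurable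
    · intro ω
      by_cases h : ω ∈ G
      · simpa [h] using hG ω h
      · simpa [h] using continuous_const
    · intro t
      exact (hW.measurable t).indicator hGm
  · filter_upwards [hGμ] with ω hω t
    simp [indicator_of_mem (show ω ∈ G from hω)]

/-- The exponential functional of the past of the Brownian motion. -/
def pastExp (W : ℝ → Ω → ℝ) (r κ : ℝ) (ω : Ω) : ENNReal :=
  ∫⁻ s in Iic (0 : ℝ), ENNReal.ofReal (Real.exp (r * s + κ * W s ω))

theorem IsTwoSidedBrownian.aemeasurable_pastExp (hW : IsTwoSidedBrownian W μ) (r κ : ℝ) :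
    AEMeasurable (pastExp W r κ) μ := by
  obtain ⟨W', hm, hae⟩ := hW.exists_modification
  refine ⟨pastExp W' r κ, ?_, ?_⟩
  · have h : Measurable fun p : Ω × ℝ =>
        ENNReal.ofReal (Real.exp (r * p.2 + κ * W' p.2 p.1)) := by
      have := hm.comp measurable_swap (α := Ω × ℝ)
      have h' : Measurable fun p : Ω × ℝ => W' p.2 p.1 := this
      fun_prop
    exact h.lintegral_prod_right'
  · filter_upwards [hae] with ω hω
    simp [pastExp, hω]

/-- Tonelli, for which the jointly measurable modification is needed, and E e^{κ W_s} = e^{κ²|s|/2}.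
-/
theorem IsTwoSidedBrownian.lintegral_pastExp [SFinite μ] (hW : IsTwoSidedBrownian W μ) {r κ : ℝ}
    (h : κ ^ 2 / 2 < r) :
    ∫⁻ ω, pastExp W r κ ω ∂μ = ENNReal.ofReal (1 / (r - κ ^ 2 / 2)) := by
  obtain ⟨W', hm, hae⟩ := hW.exists_modification
  have h1 : ∫⁻ ω, pastExp W r κ ω ∂μ = ∫⁻ ω, pastExp W' r κ ω ∂μ := by
    refine lintegral_congr_ae ?_
    filter_upwards [hae] with ω hω
    simp [pastExp, hω]
  have hm' : Measurable fun p : Ω × ℝ =>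
      ENNReal.ofReal (Real.exp (r * p.2 + κ * W' p.2 p.1)) := by
    have := hm.comp measurable_swap (α := Ω × ℝ)
    have h' : Measurable fun p : Ω × ℝ => W' p.2 p.1 := this
    fun_prop
  have h2 : ∀ s ∈ Iic (0 : ℝ), ∫⁻ ω, ENNReal.ofReal (Real.exp (r * s + κ * W' s ω)) ∂μ
      = ENNReal.ofReal (Real.exp ((r - κ ^ 2 / 2) * s)) := by
    intro s hs
    have : ∫⁻ ω, ENNReal.ofReal (Real.exp (r * s + κ * W' s ω)) ∂μ
        = ∫⁻ ω, ENNReal.ofReal (Real.exp (r * s)) *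
            ENNReal.ofReal (Real.exp (κ * W s ω)) ∂μ := by
      refine lintegral_congr_ae ?_
      filter_upwards [hae] with ω hω
      rw [hω, Real.exp_add, ENNReal.ofReal_mul (Real.exp_pos _).le]
    rw [this, lintegral_const_mul' _ _ ENNReal.ofReal_ne_top, hW.lintegral_exp κ hs,
      ← ENNReal.ofReal_mul (Real.exp_pos _).le, ← Real.exp_add]
    congr 2; ring
  have hpos : 0 < r - κ ^ 2 / 2 := by linarith
  rw [h1]
  unfold pastExp
  rw [lintegral_lintegral_swap hm'.aemeasurable, setLIntegral_congr_fun measurableSet_Iic h2,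
    ← ofReal_integral_eq_lintegral_ofReal (integrableOn_exp_mul_Iic hpos 0)
      (Eventually.of_forall fun x => (Real.exp_pos _).le), integral_exp_mul_Iic hpos]
  simp

theorem IsTwoSidedBrownian.ae_integrableOn [SFinite μ] (hW : IsTwoSidedBrownian W μ) {r κ : ℝ}
    (h : κ ^ 2 / 2 < r) :
    ∀ᵐ ω ∂μ, IntegrableOn (fun s => Real.exp (r * s + κ * W s ω)) (Iic 0) := by
  have h1 : ∫⁻ ω, pastExp W r κ ω ∂μ ≠ ⊤ := by
    rw [hW.lintegral_pastExp h]; exact ENNReal.ofReal_ne_top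
  filter_upwards [ae_lt_top' (hW.aemeasurable_pastExp r κ) h1, hW.ae_continuous] with ω hω hc
  refine ⟨(by fun_prop : Continuous _).aestronglyMeasurable, ?_⟩
  rw [hasFiniteIntegral_iff_ofReal (Eventually.of_forall fun x => (Real.exp_pos _).le)]
  exact hω

theorem IsTwoSidedBrownian.ae_integrableOn_OU [SFinite μ] (hW : IsTwoSidedBrownian W μ) :
    ∀ᵐ ω ∂μ, IntegrableOn (fun s => Real.exp s * W s ω) (Iic 0) := by
  filter_upwards [hW.ae_integrableOn (r := 1) (κ := 1) (by norm_num),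
    hW.ae_integrableOn (r := 1) (κ := -1) (by norm_num), hW.ae_continuous] with ω h1 h2 hc
  refine (h1.add h2).mono' (by fun_prop : Continuous _).aestronglyMeasurable ?_
  refine Eventually.of_forall fun s => ?_
  simp only [Pi.add_apply, one_mul, Real.exp_add, ← mul_add, norm_mul, Real.norm_eq_abs,
    Real.abs_exp]
  gcongr
  -- Domination by |w| ≤ e^w + e^{-w}.
  have h3 := Real.add_one_le_exp (W s ω)
  have h4 := Real.add_one_le_exp (-1 * W s ω)
  have h5 := Real.exp_pos (W s ω)
  have h6 := Real.exp_pos (-1 * W s ω)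
  rw [abs_le]
  constructor <;> linarith

/-- Markov's inequality. The margin δ is what makes the bound independent of `r` and `κ`. -/
theorem IsTwoSidedBrownian.meas_integral_gt_le [SFinite μ] (hW : IsTwoSidedBrownian W μ)
    {r κ δ R : ℝ} (hδ : 0 < δ) (h : κ ^ 2 / 2 + δ ≤ r) (hR : 0 < R) :
    μ {ω | ¬ ∫ s in Iic (0 : ℝ), Real.exp (r * s + κ * W s ω) ≤ R} ≤ ENNReal.ofReal (1 / (δ * R)) := by
  have hlt : κ ^ 2 / 2 < r := by linarith
  have h1 : μ {ω | ¬ ∫ s in Iic (0 : ℝ), Real.exp (r * s + κ * W s ω) ≤ R}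
      ≤ μ {ω | ENNReal.ofReal R ≤ pastExp W r κ ω} := by
    refine measure_mono_ae ?_
    filter_upwards [hW.ae_integrableOn hlt] with ω hi hω
    change ¬ _ ≤ R at hω
    change ENNReal.ofReal R ≤ pastExp W r κ ω
    rw [pastExp, ← ofReal_integral_eq_lintegral_ofReal hi
      (Eventually.of_forall fun x => (Real.exp_pos _).le)]
    exact ENNReal.ofReal_le_ofReal (not_le.1 hω).le
  refine h1.trans ((meas_ge_le_lintegral_div (hW.aemeasurable_pastExp r κ)
    (ENNReal.ofReal_pos.2 hR).ne' ENNReal.ofReal_ne_top).trans ?_)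
  rw [hW.lintegral_pastExp hlt, ← ENNReal.ofReal_div_of_pos hR]
  refine ENNReal.ofReal_le_ofReal ?_
  rw [div_div]
  gcongr
  linarith

/-- The paths exceeding the level `R` in absolute value before time `T`, as seen along a dense
sequence of times. -/
def exceedSet (T R : ℝ) : Set (NNReal → ℝ) :=
  {f | ∃ n : ℕ, (TopologicalSpace.denseSeq NNReal n : ℝ) < T ∧
    R < |f (TopologicalSpace.denseSeq NNReal n)|}

theorem measurableSet_exceedSet (T R : ℝ) : MeasurableSet (exceedSet T R) := by
  have : exceedSet T R = ⋃ n : ℕ, {f | (TopologicalSpace.denseSeq NNReal n : ℝ) < T ∧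
      R < |f (TopologicalSpace.denseSeq NNReal n)|} := by
    ext f; simp [exceedSet]
  rw [this]
  refine MeasurableSet.iUnion fun n => ?_
  refine (MeasurableSet.const _).inter ?_
  exact measurableSet_lt measurable_const (measurable_pi_apply _).abs

/-- Both inequalities are strict, so the times concerned form an open set, which the dense sequence
meets. -/
theorem mem_exceedSet {f : NNReal → ℝ} (hf : Continuous f) {T R : ℝ} {t : NNReal}
    (ht : (t : ℝ) < T) (hR : R < |f t|) : f ∈ exceedSet T R := by
  have ho : IsOpen {t : NNReal | (t : ℝ) < T ∧ R < |f t|} :=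
    (isOpen_lt NNReal.continuous_coe continuous_const).inter
      (isOpen_lt continuous_const hf.abs)
  obtain ⟨n, hn⟩ := (TopologicalSpace.denseRange_denseSeq NNReal).exists_mem_open ho ⟨t, ht, hR⟩
  exact ⟨n, hn⟩

/-- Finite-dimensional laws determine the law on path space; this transfers `exceedSet` from W to
its rescaling. -/
theorem _root_.ProbabilityTheory.IsPreBrownianReal.map_eq [IsFiniteMeasure μ]
    {B B' : NNReal → Ω → ℝ}
    (hB : IsPreBrownianReal B μ) (hB' : IsPreBrownianReal B' μ) (hm : ∀ t, Measurable (B t))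
    (hm' : ∀ t, Measurable (B' t)) :
    μ.map (fun ω t => B t ω) = μ.map (fun ω t => B' t ω) := by
  rw [map_eq_iff_forall_finset_map_restrict_eq (measurable_pi_lambda _ hm).aemeasurable
    (measurable_pi_lambda _ hm').aemeasurable]
  intro I
  rw [(hB.hasLaw I).map_eq, (hB'.hasLaw I).map_eq]

/-- Continuity from above: a continuous path is bounded on a compact interval, so it cannot exceed
every level. -/
theorem tendsto_measure_exceedSet [IsFiniteMeasure μ] {B : NNReal → Ω → ℝ}
    (hB : IsBrownianReal B μ) (hm : ∀ t, Measurable (B t)) (T : ℝ) :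
    Tendsto (fun R : ℕ => μ.map (fun ω t => B t ω) (exceedSet T R)) atTop (𝓝 0) := by
  have hmB : Measurable (fun ω t => B t ω) := measurable_pi_lambda _ hm
  have hanti : Antitone fun R : ℕ => exceedSet T R := by
    rintro R R' hR f ⟨n, h1, h2⟩
    exact ⟨n, h1, lt_of_le_of_lt (by exact_mod_cast hR) h2⟩
  have := tendsto_measure_iInter_atTop (μ := μ.map (fun ω t => B t ω))
    (fun R : ℕ => (measurableSet_exceedSet T R).nullMeasurableSet) hanti
    ⟨0, measure_ne_top _ _⟩
  suffices h0 : μ.map (fun ω t => B t ω) (⋂ R : ℕ, exceedSet T R) = 0 by rwa [h0] at this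
  rw [Measure.map_apply hmB (MeasurableSet.iInter fun R : ℕ => measurableSet_exceedSet T R)]
  refine measure_mono_null (t := {ω | ¬ Continuous fun t => B t ω}) ?_ hB.cont
  intro ω hω hcont
  obtain ⟨K, hK⟩ := ((isCompact_Icc (a := (0 : NNReal)) (b := T.toNNReal)).bddAbove_image
    (f := fun t => |B t ω|) hcont.abs.continuousOn)
  obtain ⟨R, hR⟩ := exists_nat_gt K
  obtain ⟨n, hn, hlt⟩ := mem_iInter.1 hω R
  have hle := hK (mem_image_of_mem (fun t => |B t ω|)
    (⟨zero_le, NNReal.le_toNNReal_of_coe_le hn.le⟩ : TopologicalSpace.denseSeq NNReal n ∈ Icc 0 T.toNNReal))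
  exact absurd (hlt.trans_le hle) (not_lt.2 hR.le)

/-- Brownian scaling: the maximum of `√ε |W|` over `[0, T / ε]` is tight, uniformly in `ε`. -/
theorem IsTwoSidedBrownian.exists_sup_bound [IsFiniteMeasure μ] (hW : IsTwoSidedBrownian W μ)
    (T : ℝ) {η : ENNReal} (hη : 0 < η) :
    ∃ R : ℝ, 0 ≤ R ∧ ∀ ε : ℝ, 0 < ε →
      μ {ω | ¬ ∀ t ∈ Icc 0 (T / ε), Real.sqrt ε * |W t ω| ≤ R} ≤ η := by
  have hm : ∀ t : NNReal, Measurable (W t) := fun t => hW.measurable t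
  -- `T + 1` because `exceedSet` only sees times strictly below its bound, whereas time T must be
  -- included.
  obtain ⟨R, hR⟩ := ((tendsto_measure_exceedSet hW.forward hm (T + 1)).eventually
    (ge_mem_nhds hη)).exists
  refine ⟨R, Nat.cast_nonneg R, fun ε hε => le_trans ?_ hR⟩
  -- With c = 1/ε, the process t ↦ √ε W_{t/ε} is again a Brownian motion.
  set c : NNReal := ⟨ε⁻¹, (inv_pos.2 hε).le⟩ with hc
  have hc0 : c ≠ 0 := by
    intro h
    have : (c : ℝ) = 0 := by rw [h]; rfl
    exact (inv_pos.2 hε).ne' this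
  have hsqrt : (Real.sqrt (c : ℝ))⁻¹ = Real.sqrt ε := by
    change (Real.sqrt ε⁻¹)⁻¹ = _
    rw [Real.sqrt_inv, inv_inv]
  have hB' := hW.forward.smul hc0
  have hm' : ∀ t : NNReal, Measurable fun ω => (Real.sqrt (c : ℝ))⁻¹ * W ((c * t : NNReal) : ℝ) ω :=
    fun t => (hW.measurable _).const_mul _
  rw [hW.forward.map_eq hB'.toIsPreBrownianReal hm hm',
    Measure.map_apply (measurable_pi_lambda _ hm') (measurableSet_exceedSet _ _)]
  refine measure_mono_ae ?_
  filter_upwards [hB'.cont] with ω hcont hω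
  change ¬ ∀ t ∈ Icc 0 (T / ε), Real.sqrt ε * |W t ω| ≤ R at hω
  push Not at hω
  obtain ⟨t, ht, hlt⟩ := hω
  refine mem_exceedSet hcont (t := ⟨ε * t, mul_nonneg hε.le ht.1⟩) ?_ ?_
  · change ε * t < T + 1
    have := (le_div_iff₀' hε).1 ht.2
    linarith
  · rw [hsqrt, abs_mul, abs_of_nonneg (Real.sqrt_nonneg ε)]
    change _ < Real.sqrt ε * |W (ε⁻¹ * (ε * t)) ω|
    rwa [inv_mul_cancel_left₀ hε.ne']

end NoiseEstimates

/-! ### Pathwise calculus: removing the noise by random factors -/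

section Pathwise

theorem integrableOn_Iic_of_continuous {g : ℝ → ℝ} (hg : Continuous g)
    (hi : IntegrableOn g (Iic 0)) (t : ℝ) : IntegrableOn g (Iic t) := by
  rcases le_total t 0 with h | h
  · exact hi.mono_set (Iic_subset_Iic.2 h)
  · rw [← Iic_union_Icc_eq_Iic h]
    exact hi.union hg.continuousOn.integrableOn_Icc

theorem integral_Iic_eq_add {g : ℝ → ℝ} (hg : Continuous g) (hi : IntegrableOn g (Iic 0)) (t : ℝ) :
    ∫ s in Iic t, g s = (∫ s in Iic 0, g s) + ∫ s in (0 : ℝ)..t, g s := by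
  rw [← intervalIntegral.integral_Iic_sub_Iic hi (integrableOn_Iic_of_continuous hg hi t)]
  ring

theorem hasDerivAt_integral_Iic {g : ℝ → ℝ} (hg : Continuous g) (hi : IntegrableOn g (Iic 0))
    (t : ℝ) : HasDerivAt (fun t => ∫ s in Iic t, g s) (g t) t := by
  rw [funext (integral_Iic_eq_add hg hi)]
  exact (hg.integral_hasStrictDerivAt 0 t).hasDerivAt.const_add _

theorem integral_Iic_add_left (f : ℝ → ℝ) (t : ℝ) :
    ∫ s in Iic (0 : ℝ), f (t + s) = ∫ s in Iic t, f s := by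
  have h := (measurePreserving_add_left volume t).setIntegral_preimage_emb
    (measurableEmbedding_addLeft t) f (Iic t)
  rw [← h]
  congr 2
  ext s; simp

variable {Ω : Type*} {W : ℝ → Ω → ℝ} {ω : Ω}

/-- After the shift of variable, W_t enters only through the factor e^{-σ W_t}; the rest is
differentiable in t. -/
theorem M_eq (σ : ℝ) (β : ℕ+ → ℝ) (n : ℕ+) (t : ℝ) :
    M W σ β n t ω = Real.exp (-(σ * W t ω)) * (Real.exp (-((2 * β 1 - β n) * t)) *
      ∫ s in Iic t, Real.exp ((2 * β 1 - β n) * s + σ * W s ω)) := by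
  rw [M, ← integral_Iic_add_left _ t, ← integral_const_mul, ← integral_const_mul]
  refine integral_congr_ae (Eventually.of_forall fun s => ?_)
  simp only [← Real.exp_add]
  congr 1; ring

theorem OU_eq (hc : Continuous fun t => W t ω)
    (hi : IntegrableOn (fun s => Real.exp s * W s ω) (Iic 0)) (σ t : ℝ) :
    OU W σ t ω = σ * W t ω - σ * (Real.exp (-t) * ∫ s in Iic t, Real.exp s * W s ω) := by
  have h1 : IntegrableOn (fun s => Real.exp s * W (t + s) ω) (Iic 0) := by
    have h2 := (measurePreserving_add_left volume t).integrableOn_comp_preimage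
      (measurableEmbedding_addLeft t) (f := fun s => Real.exp s * W s ω) (s := Iic t)
    have h3 := (h2.2 (integrableOn_Iic_of_continuous (by fun_prop) hi t)).const_mul (Real.exp (-t))
    have h4 : (fun x => t + x) ⁻¹' Iic t = Iic (0 : ℝ) := by ext s; simp
    rw [h4] at h3
    refine h3.congr (Eventually.of_forall fun s => ?_)
    simp only [Function.comp]
    rw [← mul_assoc, ← Real.exp_add]
    congr 2; ring
  have h5 : ∫ s in Iic (0 : ℝ), Real.exp s * (W (t + s) ω - W t ω)
      = (Real.exp (-t) * ∫ s in Iic t, Real.exp s * W s ω) - W t ω := by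
    simp_rw [mul_sub]
    rw [integral_sub h1 ((integrableOn_exp_Iic 0).mul_const _), integral_mul_const,
      integral_exp_Iic_zero, one_mul, ← integral_Iic_add_left _ t, ← integral_const_mul]
    congr 1
    refine integral_congr_ae (Eventually.of_forall fun s => ?_)
    simp only []
    rw [← mul_assoc, ← Real.exp_add]
    congr 2; ring
  rw [OU, h5]; ring

/-- The equation dZ = -Z dt + σ dW, read path by path: the rough parts of Z and σW cancel. -/
theorem hasDerivAt_OU_sub (hc : Continuous fun t => W t ω)
    (hi : IntegrableOn (fun s => Real.exp s * W s ω) (Iic 0)) (σ t : ℝ) :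
    HasDerivAt (fun t => OU W σ t ω - σ * W t ω) (-OU W σ t ω) t := by
  have h1 := hasDerivAt_integral_Iic (g := fun s => Real.exp s * W s ω) (by fun_prop) hi t
  have h2 : HasDerivAt (fun t : ℝ => Real.exp (-t)) (-Real.exp (-t)) t := by
    simpa using (hasDerivAt_id t).neg.exp
  have h3 := ((h2.mul h1).const_mul σ).neg
  have h4 : (fun t => OU W σ t ω - σ * W t ω)
      = fun t => -(σ * (Real.exp (-t) * ∫ s in Iic t, Real.exp s * W s ω)) := by
    funext s; rw [OU_eq hc hi]; ring
  have h5 : Real.exp (-t) * (Real.exp t * W t ω) = W t ω := by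
    rw [← mul_assoc, ← Real.exp_add]; simp
  rw [h4]
  refine HasDerivAt.congr_deriv h3 ?_
  rw [h5, OU_eq hc hi]; ring

/-- Multiplying by `e^{-σ W}` turns a solution of the Stratonovich equation into a classical
solution of an equation with random coefficients. -/
theorem hasDerivAt_exp_neg_smul {E : Type*} [NormedAddCommGroup E] [NormedSpace ℝ E]
    (hc : Continuous fun t => W t ω)
    (hi : IntegrableOn (fun s => Real.exp s * W s ω) (Iic 0)) {σ t : ℝ} {u : ℝ → E} {D : E}
    (hd : HasDerivAt (fun s => Real.exp (-OU W σ s ω) • u s)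
      (OU W σ t ω • (Real.exp (-OU W σ t ω) • u t) + Real.exp (-OU W σ t ω) • D) t) :
    HasDerivAt (fun s => Real.exp (-(σ * W s ω)) • u s) (Real.exp (-(σ * W t ω)) • D) t := by
  -- e^{-σW} = e^{Z-σW} e^{-Z}; the derivative -Z of the exponent Z - σW cancels the term Zv.
  have h1 := (hasDerivAt_OU_sub hc hi σ t).exp.smul hd
  have key : ∀ s, Real.exp (OU W σ s ω - σ * W s ω) * Real.exp (-OU W σ s ω)
      = Real.exp (-(σ * W s ω)) := fun s => by rw [← Real.exp_add]; congr 1; ring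
  have h2 : (fun s => Real.exp (-(σ * W s ω)) • u s)
      = fun s => Real.exp (OU W σ s ω - σ * W s ω) • Real.exp (-OU W σ s ω) • u s := by
    funext s
    rw [smul_smul, key]
  rw [h2]
  refine HasDerivAt.congr_deriv h1 ?_
  · simp only [smul_add, smul_smul]
    rw [key]
    rw [show (Real.exp (OU W σ t ω - σ * W t ω) * -OU W σ t ω) * Real.exp (-OU W σ t ω)
      = -(OU W σ t ω * Real.exp (-(σ * W t ω))) by rw [← key]; ring]
    rw [show Real.exp (OU W σ t ω - σ * W t ω) * (OU W σ t ω * Real.exp (-OU W σ t ω))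
      = OU W σ t ω * Real.exp (-(σ * W t ω)) by rw [← key]; ring]
    simp

theorem continuousOn_exp_neg_smul {E : Type*} [NormedAddCommGroup E] [NormedSpace ℝ E]
    (hc : Continuous fun t => W t ω)
    (hi : IntegrableOn (fun s => Real.exp s * W s ω) (Iic 0)) {σ : ℝ} {u : ℝ → E} {I : Set ℝ}
    (hu : ContinuousOn (fun s => Real.exp (-OU W σ s ω) • u s) I) :
    ContinuousOn (fun s => Real.exp (-(σ * W s ω)) • u s) I := by
  have h1 : Continuous fun t => OU W σ t ω - σ * W t ω :=
    continuous_iff_continuousAt.2 fun t => (hasDerivAt_OU_sub hc hi σ t).continuousAt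
  refine (h1.rexp.continuousOn.smul hu).congr fun s _ => ?_
  simp only [Pi.smul_apply', smul_smul, ← Real.exp_add]
  congr 2; ring

/-- Solution formula for a linear homogeneous scalar equation on `[0, ∞)`. -/
theorem eq_mul_exp_integral {y k : ℝ → ℝ} (hy : ContinuousOn y (Ici 0))
    (hk : ContinuousOn k (Ici 0)) (hd : ∀ t, 0 < t → HasDerivAt y (k t * y t) t) {t : ℝ}
    (ht : 0 ≤ t) : y t = y 0 * Real.exp (∫ s in (0 : ℝ)..t, k s) := by
  -- Constant extension to the left of 0, so that the primitive is differentiable on the whole line.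
  set k' : ℝ → ℝ := fun s => k (max s 0) with hk'
  have hk'c : Continuous k' :=
    hk.comp_continuous (by fun_prop) fun s => le_max_right s 0
  have hK : ∀ s, HasDerivAt (fun s => ∫ x in (0 : ℝ)..s, k' x) (k' s) s := fun s =>
    (hk'c.integral_hasStrictDerivAt 0 s).hasDerivAt
  set F : ℝ → ℝ := fun s => y s * Real.exp (-∫ x in (0 : ℝ)..s, k' x) with hF
  have hKc : Continuous fun s => ∫ x in (0 : ℝ)..s, k' x :=
    continuous_iff_continuousAt.2 fun s => (hK s).continuousAt
  have hFc : ContinuousOn F (Ici 0) := hy.mul (by fun_prop)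
  have hF' : ∀ s ∈ interior (Ici (0 : ℝ)), HasDerivAt F 0 s := by
    intro s hs
    rw [interior_Ici] at hs
    have := (hd s hs).mul (hK s).neg.exp
    refine HasDerivAt.congr_deriv this ?_
    have h1 : k' s = k s := by rw [hk']; simp [max_eq_left (le_of_lt (mem_Ioi.1 hs))]
    rw [h1]
    simp only [Pi.neg_apply]
    ring
  have hconst : F t = F 0 := by
    refine le_antisymm ?_ ?_
    · exact antitoneOn_of_deriv_nonpos (convex_Ici 0) hFc
        (fun s hs => (hF' s hs).differentiableAt.differentiableWithinAt)
        (fun s hs => (hF' s hs).deriv.le) self_mem_Ici ht ht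
    · exact monotoneOn_of_deriv_nonneg (convex_Ici 0) hFc
        (fun s hs => (hF' s hs).differentiableAt.differentiableWithinAt)
        (fun s hs => (hF' s hs).deriv.ge) self_mem_Ici ht ht
  have hint : ∫ x in (0 : ℝ)..t, k' x = ∫ x in (0 : ℝ)..t, k x := by
    refine intervalIntegral.integral_congr fun s hs => ?_
    rw [uIcc_of_le ht] at hs
    simp only [hk', max_eq_left hs.1]
  simp only [hF, intervalIntegral.integral_same, neg_zero, Real.exp_zero, mul_one] at hconst
  rw [← hconst, hint, mul_assoc, ← Real.exp_add]
  simp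

/-- Noise-free form of dM = (1 - (2β_1 - β_n) M) dt - σ M ∘ dW. -/
theorem hasDerivAt_exp_mul_M (hc : Continuous fun t => W t ω) {σ : ℝ} {β : ℕ+ → ℝ} {n : ℕ+}
    (hi : IntegrableOn (fun s => Real.exp ((2 * β 1 - β n) * s + σ * W s ω)) (Iic 0)) (t : ℝ) :
    HasDerivAt (fun t => Real.exp (σ * W t ω) * M W σ β n t ω)
      (Real.exp (σ * W t ω)
        - (2 * β 1 - β n) * (Real.exp (σ * W t ω) * M W σ β n t ω)) t := by
  have h1 := hasDerivAt_integral_Iic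
    (g := fun s => Real.exp ((2 * β 1 - β n) * s + σ * W s ω)) (by fun_prop) hi t
  have h2 : HasDerivAt (fun t : ℝ => Real.exp (-((2 * β 1 - β n) * t)))
      (Real.exp (-((2 * β 1 - β n) * t)) * -(2 * β 1 - β n)) t := by
    simpa using ((hasDerivAt_id t).const_mul (2 * β 1 - β n)).neg.exp
  have h3 := h2.mul h1
  have key : ∀ s, Real.exp (σ * W s ω) * M W σ β n s ω
      = Real.exp (-((2 * β 1 - β n) * s)) *
        ∫ x in Iic s, Real.exp ((2 * β 1 - β n) * x + σ * W x ω) := fun s => by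
    rw [M_eq, ← mul_assoc, ← Real.exp_add]; simp
  rw [funext key, key]
  refine HasDerivAt.congr_deriv h3 ?_
  rw [← Real.exp_add, neg_add_cancel_left]
  ring

theorem integral_exp_mul_sub_le {r t : ℝ} (hr : 0 < r) :
    ∫ s in (0 : ℝ)..t, Real.exp (r * (s - t)) ≤ 1 / r := by
  have : ∫ s in (0 : ℝ)..t, Real.exp (r * (s - t)) = (1 - Real.exp (-(r * t))) / r := by
    have hd : ∀ s ∈ uIcc 0 t, HasDerivAt (fun s => Real.exp (r * (s - t)) / r)
        (Real.exp (r * (s - t))) s := by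
      intro s _
      have := ((((hasDerivAt_id s).sub_const t).const_mul r).exp).div_const r
      simpa [hr.ne'] using this
    rw [intervalIntegral.integral_eq_sub_of_hasDerivAt hd
      ((by fun_prop : Continuous _).intervalIntegrable _ _)]
    simp [sub_div]
  rw [this]
  gcongr
  have := Real.exp_pos (-(r * t))
  linarith

/-- Bounds on `M_{11}^n`, uniform in `n`, from bounds on the path. -/
theorem M_mem_Icc (hc : Continuous fun t => W t ω) {σ r δ R R' t : ℝ} {β : ℕ+ → ℝ} {n : ℕ+}
    (hδ : 0 < δ) (hδr : δ ≤ r) (hn : r ≤ 2 * β 1 - β n)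
    (hi : IntegrableOn (fun s => Real.exp (r * s + σ * W s ω)) (Iic 0))
    (hR' : ∫ s in Iic (0 : ℝ), Real.exp (r * s + σ * W s ω) ≤ R') (ht : 0 ≤ t)
    (hR : ∀ s ∈ Icc 0 t, |σ * W s ω| ≤ R) :
    M W σ β n t ω ∈ Icc 0 (Real.exp R * (R' + Real.exp R / δ)) := by
  have hr : 0 < r := hδ.trans_le hδr
  have hit := integrableOn_Iic_of_continuous (by fun_prop) hi t
  refine ⟨integral_nonneg fun s => (Real.exp_pos _).le, ?_⟩
  rw [M_eq, ← integral_const_mul]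
  -- As s ≤ t, lowering the decay rate to `r` only increases the kernel; this makes the bound
  -- uniform in n.
  have h1 : ∫ s in Iic t, Real.exp (-((2 * β 1 - β n) * t)) *
        Real.exp ((2 * β 1 - β n) * s + σ * W s ω)
      ≤ ∫ s in Iic t, Real.exp (-(r * t)) * Real.exp (r * s + σ * W s ω) := by
    refine integral_mono_of_nonneg (Eventually.of_forall fun s => by positivity)
      (hit.const_mul _) ?_
    filter_upwards [ae_restrict_mem measurableSet_Iic] with s hs
    rw [← Real.exp_add, ← Real.exp_add]
    refine Real.exp_le_exp.2 ?_
    nlinarith [mem_Iic.1 hs]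
  have h2 : ∫ s in Iic t, Real.exp (-(r * t)) * Real.exp (r * s + σ * W s ω)
      ≤ R' + Real.exp R / δ := by
    -- The past before 0 is bounded by `R'`, the stretch [0, t] by the path bound and the decaying
    -- kernel.
    rw [integral_const_mul, integral_Iic_eq_add (by fun_prop) hi, mul_add]
    have h0 : 0 ≤ ∫ s in Iic (0 : ℝ), Real.exp (r * s + σ * W s ω) :=
      integral_nonneg fun s => (Real.exp_pos _).le
    refine add_le_add ?_ ?_
    · have : Real.exp (-(r * t)) ≤ 1 := Real.exp_le_one_iff.2 (by nlinarith)
      calc _ ≤ 1 * ∫ s in Iic (0 : ℝ), Real.exp (r * s + σ * W s ω) := by gcongr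
        _ ≤ R' := by rwa [one_mul]
    · rw [← intervalIntegral.integral_const_mul]
      calc ∫ s in (0 : ℝ)..t, Real.exp (-(r * t)) * Real.exp (r * s + σ * W s ω)
          ≤ ∫ s in (0 : ℝ)..t, Real.exp R * Real.exp (r * (s - t)) := by
            refine intervalIntegral.integral_mono_on ht
              ((by fun_prop : Continuous _).intervalIntegrable _ _)
              ((by fun_prop : Continuous _).intervalIntegrable _ _) fun s hs => ?_
            rw [← Real.exp_add, ← Real.exp_add]
            refine Real.exp_le_exp.2 ?_
            have := (abs_le.1 (hR s hs)).2
            linarith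
        _ = Real.exp R * ∫ s in (0 : ℝ)..t, Real.exp (r * (s - t)) :=
            intervalIntegral.integral_const_mul _ _
        _ ≤ Real.exp R * (1 / δ) := by
            gcongr
            exact (integral_exp_mul_sub_le hr).trans (one_div_le_one_div_of_le hδ hδr)
        _ = _ := by ring
  refine mul_le_mul (Real.exp_le_exp.2 ?_) (h1.trans h2) (integral_nonneg fun s => by positivity)
    (Real.exp_pos _).le
  have := (abs_le.1 (hR t ⟨ht, le_rfl⟩)).1
  linarith

end Pathwise

/-! ### Consequences of energy conservation -/

section Energy

variable {H V : Type*} [NormedAddCommGroup H] [InnerProductSpace ℝ H]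
  [NormedAddCommGroup V] [NormedSpace ℝ V]

/-- Polarization: subtracting the identities at u + v and u - v isolates the terms odd in v, and the
one cubic in v vanishes. -/
theorem inner_add_inner_of_energy (S : LinearFamily H V) (B : V →L[ℝ] V →L[ℝ] H)
    (h : ∀ u : V, inner ℝ (B u u) (S.emb u) = 0) (u v : V) :
    inner ℝ (B u v + B v u) (S.emb u) = -inner ℝ (B u u) (S.emb v) := by
  have h1 := h (u + v)
  have h2 := h (u - v)
  have h3 := h u
  have h4 := h v
  simp only [map_add, map_sub, add_apply, sub_apply, inner_add_left, inner_add_right,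
    inner_sub_left, inner_sub_right] at h1 h2
  rw [inner_add_left]
  linarith

theorem Fc_eq (S : LinearFamily H V) (B : V →L[ℝ] V →L[ℝ] H)
    (h : ∀ u : V, inner ℝ (B u u) (S.emb u) = 0) (e : ℕ+ → S.A.domain) (v : V) :
    Fc S B e v = -inner ℝ (B (S.inc (e 1)) (S.inc (e 1))) (S.emb v) := by
  rw [← inner_add_inner_of_energy S B h, Fc, S.emb_inc]

theorem inner_projStable {e₁ f : H} (h : inner ℝ e₁ f = (0 : ℝ)) (x : H) :
    inner ℝ (projStable e₁ x) f = (inner ℝ x f : ℝ) := by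
  rw [projStable, inner_sub_left, real_inner_smul_left, h, mul_zero, sub_zero]

theorem evalOp_of_mem {T : H →ₗ.[ℝ] H} {x : H} (h : x ∈ T.domain) :
    evalOp T x = T ⟨x, h⟩ := by
  simp [evalOp, h]

/-- Beyond N both sides vanish, so the truncation of the sum plays no role from here on. -/
theorem inner_emb_param {Ω : Type*} (S : LinearFamily H V) (B : V →L[ℝ] V →L[ℝ] H)
    (W : ℝ → Ω → ℝ) (σ : ℝ) (β : ℕ+ → ℝ) {e : ℕ+ → S.A.domain}
    (he : Orthonormal ℝ fun n => (e n : H)) {N : ℕ+}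
    (hN : ∀ n : ℕ+, N < n → coef S B e 1 1 n = 0) (X t : ℝ) (ω : Ω) {n : ℕ+} (hn : 2 ≤ n) :
    inner ℝ (S.emb (param S B W σ β e N X t ω)) (e n : H)
      = coef S B e 1 1 n * M W σ β n t ω * X ^ 2 := by
  have hort := orthonormal_iff_ite.1 he
  simp only [param, map_sum, map_smul, S.emb_inc, sum_inner, real_inner_smul_left, hort,
    mul_ite, mul_one, mul_zero, Finset.sum_ite_eq', Finset.mem_Icc]
  split_ifs with h
  · rfl
  · rw [hN n (not_le.1 fun h' => h ⟨hn, h'⟩)]; ring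

end Energy

/-! ### Invariance of the manifold and pathwise bounds -/

section PathwiseSurrogate

variable {H Ω : Type*} [NormedAddCommGroup H] [InnerProductSpace ℝ H]
  {W : ℝ → Ω → ℝ} {ω : Ω}

theorem continuousOn_of_exp_neg_smul {E : Type*} [NormedAddCommGroup E] [NormedSpace ℝ E]
    (hc : Continuous fun t => W t ω) {σ : ℝ} {u : ℝ → E} {I : Set ℝ}
    (hu : ContinuousOn (fun s => Real.exp (-(σ * W s ω)) • u s) I) : ContinuousOn u I := by
  have h1 : Continuous fun s => Real.exp (σ * W s ω) := by fun_prop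
  refine (h1.continuousOn.smul hu).congr fun s _ => ?_
  simp only [Pi.smul_apply', smul_smul, ← Real.exp_add]
  simp

/-- The stable component of a solution of the surrogate system that starts on the
parameterizing manifold stays on it. -/
theorem inner_eq_mul_M_mul_sq (hc : Continuous fun t => W t ω) {σ : ℝ} {β : ℕ+ → ℝ} {n : ℕ+}
    {x : ℝ → ℝ} {φ D : ℝ → H} {F f : H}
    (hx : ContinuousOn (fun t => Real.exp (-(σ * W t ω)) • x t) (Ici 0))
    (hxd : ∀ t, 0 < t → HasDerivAt (fun s => Real.exp (-(σ * W s ω)) • x s)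
      (Real.exp (-(σ * W t ω)) • (β 1 * x t + x t * -inner ℝ F (φ t))) t)
    (hφ : ContinuousOn (fun t => Real.exp (-(σ * W t ω)) • φ t) (Ici 0))
    (hφd : ∀ t, 0 < t → HasDerivAt (fun s => Real.exp (-(σ * W s ω)) • φ s)
      (Real.exp (-(σ * W t ω)) • D t) t)
    (hD : ∀ t, 0 < t → inner ℝ (D t) f
      = β n * inner ℝ (φ t) f + x t ^ 2 * inner ℝ F f + 2 * -inner ℝ F (φ t) * inner ℝ (φ t) f)
    (hi : IntegrableOn (fun s => Real.exp ((2 * β 1 - β n) * s + σ * W s ω)) (Iic 0))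
    (h0 : inner ℝ (φ 0) f = inner ℝ F f * M W σ β n 0 ω * x 0 ^ 2) {t : ℝ} (ht : 0 ≤ t) :
    inner ℝ (φ t) f = inner ℝ F f * M W σ β n t ω * x t ^ 2 := by
  set a : ℝ → ℝ := fun t => Real.exp (-(σ * W t ω)) • x t with ha
  set p : ℝ → ℝ := fun t => inner ℝ (Real.exp (-(σ * W t ω)) • φ t) f with hp
  set m : ℝ → ℝ := fun t => Real.exp (σ * W t ω) * M W σ β n t ω with hm
  have hφc := continuousOn_of_exp_neg_smul hc hφ
  have hmd := hasDerivAt_exp_mul_M hc hi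
  have hmc : Continuous m := continuous_iff_continuousAt.2 fun s => (hmd s).continuousAt
  have hpc : ContinuousOn p (Ici 0) := hφ.inner continuousOn_const
  have hpd : ∀ t, 0 < t → HasDerivAt p (Real.exp (-(σ * W t ω)) * inner ℝ (D t) f) t := by
    intro t ht
    have := (hφd t ht).inner ℝ (hasDerivAt_const t f)
    refine this.congr_deriv ?_
    rw [inner_zero_right, zero_add, real_inner_smul_left]
  have hrel : ∀ s, p s - inner ℝ F f * (m s * a s ^ 2) = Real.exp (-(σ * W s ω)) *
      (inner ℝ (φ s) f - inner ℝ F f * M W σ β n s ω * x s ^ 2) := by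
    intro s
    have h1 : Real.exp (σ * W s ω) * Real.exp (-(σ * W s ω)) = 1 := by
      rw [← Real.exp_add]; simp
    simp only [hp, hm, ha, real_inner_smul_left, smul_eq_mul]
    linear_combination -(Real.exp (-(σ * W s ω)) * inner ℝ F f * M W σ β n s ω * x s ^ 2) * h1
  -- The factor 2 in 2Φ F_c(Φ) matches the growth rate of X², and the rate 2β_1 - β_n in M leaves
  -- exactly β_n; the forcing terms cancel.
  have key := eq_mul_exp_integral (y := fun s => p s - inner ℝ F f * (m s * a s ^ 2))
    (k := fun s => β n + 2 * -inner ℝ F (φ s))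
    (hpc.sub (continuousOn_const.mul (hmc.continuousOn.mul (hx.pow 2))))
    (continuousOn_const.add (continuousOn_const.mul (continuousOn_const.inner hφc).neg))
    (fun s hs => by
      have h1 := (hpd s hs).sub (((hmd s).mul ((hxd s hs).pow 2)).const_mul (inner ℝ F f))
      refine HasDerivAt.congr_deriv h1 ?_
      rw [hD s hs]
      have h1 : Real.exp (σ * W s ω) * Real.exp (-(σ * W s ω)) = 1 := by
        rw [← Real.exp_add]; simp
      simp only [Pi.pow_apply, hp, hm, ha, real_inner_smul_left, smul_eq_mul]
      push_cast
      linear_combination -(Real.exp (-(σ * W s ω)) * inner ℝ F f * x s ^ 2) * h1) ht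
  simp only [hrel] at key
  rw [h0, sub_self, mul_zero, zero_mul] at key
  have := (mul_eq_zero.1 key).resolve_left (Real.exp_ne_zero _)
  linarith

/-- The critical component grows at most like the solution of the linearized equation. -/
theorem abs_le_exp_mul (hW0 : W 0 ω = 0) {σ b : ℝ}
    {x g : ℝ → ℝ}
    (hx : ContinuousOn (fun t => Real.exp (-(σ * W t ω)) • x t) (Ici 0))
    (hxd : ∀ t, 0 < t → HasDerivAt (fun s => Real.exp (-(σ * W s ω)) • x s)
      (Real.exp (-(σ * W t ω)) • (b * x t + x t * -g t)) t)
    (hgc : ContinuousOn g (Ici 0)) (hg : ∀ t, 0 ≤ t → 0 ≤ g t) {t : ℝ} (ht : 0 ≤ t) :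
    |x t| ≤ |x 0| * Real.exp (b * t + σ * W t ω) := by
  have key := eq_mul_exp_integral (k := fun s => b - g s) hx (continuousOn_const.sub hgc)
    (fun s hs => (hxd s hs).congr_deriv (by simp only [smul_eq_mul]; ring)) ht
  have hint : ∫ s in (0 : ℝ)..t, (b - g s) ≤ b * t := by
    have hsub : uIcc 0 t ⊆ Ici 0 := by
      rw [uIcc_of_le ht]; exact Icc_subset_Ici_self
    have h1 := intervalIntegral.integral_mono_on ht
      (μ := volume) (f := fun s => b - g s) (g := fun _ => b)
      ((continuousOn_const.sub hgc).mono hsub).intervalIntegrable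
      intervalIntegrable_const
      (fun s hs => by have := hg s hs.1; linarith)
    rwa [intervalIntegral.integral_const, sub_zero, smul_eq_mul, mul_comm] at h1
  simp only [smul_eq_mul, hW0, mul_zero, neg_zero, Real.exp_zero, one_mul] at key
  have hxt : x t = x 0 * Real.exp (∫ s in (0 : ℝ)..t, (b - g s)) * Real.exp (σ * W t ω) := by
    rw [← key, mul_right_comm, ← Real.exp_add]; simp
  rw [hxt, abs_mul, abs_mul, Real.abs_exp, Real.abs_exp, mul_assoc, ← Real.exp_add]
  gcongr

/-- A vector whose coefficients are those of `F` multiplied by numbers in `[0, q]` has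
nonnegative inner product with `F` and norm at most `q ‖F‖`. -/
theorem inner_nonneg_and_norm_le_of_coeff [CompleteSpace H] {T : H →ₗ.[ℝ] H} {β : ℕ+ → ℝ}
    {e : ℕ+ → T.domain} (h : IsEigenbasis T β e) {F φ : H} {q : ℝ} (hq : 0 ≤ q)
    (hφ : ∀ n, ∃ θ ∈ Icc 0 q, inner ℝ φ (e n : H) = θ * inner ℝ F (e n : H)) :
    0 ≤ (inner ℝ F φ : ℝ) ∧ ‖φ‖ ≤ q * ‖F‖ := by
  constructor
  · refine (h.hasSum_inner F φ).nonneg fun n => ?_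
    obtain ⟨θ, hθ, hn⟩ := hφ n
    rw [hn]
    have := mul_nonneg hθ.1 (mul_self_nonneg (inner ℝ F (e n : H)))
    linarith
  · have h1 := h.hasSum_inner φ φ
    have h2 := (h.hasSum_inner F F).mul_left (q ^ 2)
    rw [real_inner_self_eq_norm_sq] at h1 h2
    refine le_of_sq_le_sq ?_ (by positivity)
    rw [mul_pow]
    refine hasSum_le (fun n => ?_) h1 h2
    obtain ⟨θ, hθ, hn⟩ := hφ n
    rw [hn]
    have h3 : θ ^ 2 ≤ q ^ 2 := pow_le_pow_left₀ hθ.1 hθ.2 2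
    have := mul_le_mul_of_nonneg_right h3 (mul_self_nonneg (inner ℝ F (e n : H)))
    linarith

/-- Pathwise bounds for the surrogate system. -/
theorem pathwise_bound [CompleteSpace H] {T : H →ₗ.[ℝ] H} {β : ℕ+ → ℝ}
    {e : ℕ+ → T.domain} (h : IsEigenbasis T β e)
    (hc : Continuous fun t => W t ω) (hW0 : W 0 ω = 0) {σ δ R R' τ : ℝ}
    {x : ℝ → ℝ} {φ D : ℝ → H} {F : H}
    (hδ : 0 < δ) (hβ1 : 0 ≤ β 1) (hβ2 : β 2 ≤ -δ)
    (hx : ContinuousOn (fun t => Real.exp (-(σ * W t ω)) • x t) (Ici 0))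
    (hxd : ∀ t, 0 < t → HasDerivAt (fun s => Real.exp (-(σ * W s ω)) • x s)
      (Real.exp (-(σ * W t ω)) • (β 1 * x t + x t * -inner ℝ F (φ t))) t)
    (hφ : ContinuousOn (fun t => Real.exp (-(σ * W t ω)) • φ t) (Ici 0))
    (hφd : ∀ t, 0 < t → HasDerivAt (fun s => Real.exp (-(σ * W s ω)) • φ s)
      (Real.exp (-(σ * W t ω)) • D t) t)
    (hD : ∀ t, 0 < t → ∀ n : ℕ+, 2 ≤ n → inner ℝ (D t) (e n : H)
      = β n * inner ℝ (φ t) (e n : H) + x t ^ 2 * inner ℝ F (e n : H)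
        + 2 * -inner ℝ F (φ t) * inner ℝ (φ t) (e n : H))
    (hφ1 : ∀ t, 0 ≤ t → inner ℝ (φ t) (e 1 : H) = 0)
    (hi : IntegrableOn (fun s => Real.exp ((2 * β 1 + δ) * s + σ * W s ω)) (Iic 0))
    (h0 : ∀ n : ℕ+, 2 ≤ n →
      inner ℝ (φ 0) (e n : H) = inner ℝ F (e n : H) * M W σ β n 0 ω * x 0 ^ 2)
    (hR' : ∫ s in Iic (0 : ℝ), Real.exp ((2 * β 1 + δ) * s + σ * W s ω) ≤ R')
    (hR : ∀ s ∈ Icc 0 τ, |σ * W s ω| ≤ R) {t : ℝ} (ht : t ∈ Icc 0 τ) :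
    |x t| ≤ |x 0| * Real.exp (β 1 * τ + R) ∧
      ‖φ t‖ ≤ Real.exp R * (R' + Real.exp R / δ) * x t ^ 2 * ‖F‖ := by
  have hR'0 : 0 ≤ R' := le_trans (integral_nonneg fun s => (Real.exp_pos _).le) hR'
  have hβn : ∀ n : ℕ+, 2 ≤ n → 2 * β 1 + δ ≤ 2 * β 1 - β n := fun n hn => by
    have := h.antitone hn; linarith
  have hin : ∀ n : ℕ+, 2 ≤ n →
      IntegrableOn (fun s => Real.exp ((2 * β 1 - β n) * s + σ * W s ω)) (Iic 0) := by
    intro n hn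
    refine hi.mono' (by fun_prop : Continuous _).aestronglyMeasurable ?_
    filter_upwards [ae_restrict_mem measurableSet_Iic] with s hs
    rw [Real.norm_eq_abs, Real.abs_exp]
    refine Real.exp_le_exp.2 ?_
    nlinarith [mem_Iic.1 hs, hβn n hn]
  have hcomp : ∀ t, 0 ≤ t → ∀ n : ℕ+, 2 ≤ n →
      inner ℝ (φ t) (e n : H) = inner ℝ F (e n : H) * M W σ β n t ω * x t ^ 2 :=
    fun t ht n hn => inner_eq_mul_M_mul_sq hc hx hxd hφ hφd (fun s hs => hD s hs n hn)
      (hin n hn) (h0 n hn) ht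
  have hbound : ∀ t, 0 ≤ t → ∀ R, (∀ s ∈ Icc 0 t, |σ * W s ω| ≤ R) →
      0 ≤ (inner ℝ F (φ t) : ℝ) ∧
      ‖φ t‖ ≤ Real.exp R * (R' + Real.exp R / δ) * x t ^ 2 * ‖F‖ := by
    intro t ht R hR
    refine inner_nonneg_and_norm_le_of_coeff h (by positivity) fun n => ?_
    by_cases hn : n = 1
    · subst hn
      exact ⟨0, ⟨le_rfl, by positivity⟩, by rw [hφ1 t ht, zero_mul]⟩
    · have hn2 : 2 ≤ n := PNat.add_one_le_iff.2 (lt_of_le_of_ne one_le (Ne.symm hn))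
      have hM := M_mem_Icc hc hδ (by linarith) (hβn n hn2) hi hR' ht hR
      exact ⟨M W σ β n t ω * x t ^ 2, ⟨mul_nonneg hM.1 (sq_nonneg _), by gcongr; exact hM.2⟩,
        by rw [hcomp t ht n hn2]; ring⟩
  -- The sign is needed at all times, also beyond τ where `R` says nothing; the maximum of the path
  -- on [0, t] serves instead.
  have hpos : ∀ t, 0 ≤ t → 0 ≤ (inner ℝ F (φ t) : ℝ) := by
    intro t ht
    obtain ⟨R₁, hR₁⟩ := (isCompact_Icc (a := (0 : ℝ)) (b := t)).bddAbove_image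
      (f := fun s => |σ * W s ω|) (by fun_prop : Continuous _).continuousOn
    exact (hbound t ht R₁ fun s hs => hR₁ (mem_image_of_mem _ hs)).1
  refine ⟨?_, (hbound t ht.1 R fun s hs => hR s ⟨hs.1, hs.2.trans ht.2⟩).2⟩
  refine (abs_le_exp_mul hW0 hx hxd
    (continuousOn_const.inner (continuousOn_of_exp_neg_smul hc hφ)) hpos ht.1).trans ?_
  have h1 := (abs_le.1 (hR t ht)).2
  have h2 : β 1 * t ≤ β 1 * τ := by gcongr; exact ht.2
  gcongr

end PathwiseSurrogate

/-! ### From the stochastic system to the pathwise bounds -/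

section Surrogate

variable {H V Ω : Type*} [NormedAddCommGroup H] [InnerProductSpace ℝ H] [CompleteSpace H]
  [NormedAddCommGroup V] [NormedSpace ℝ V] [MeasurableSpace Ω]

/-- Almost surely, the solutions of the surrogate system issued from the parameterizing manifold
are bounded in terms of the Brownian path. -/
theorem SolvesSurrogate.ae_bound {μ : Measure Ω} [IsProbabilityMeasure μ] {W : ℝ → Ω → ℝ}
    (hW : IsTwoSidedBrownian W μ) {S : LinearFamily H V} {B : V →L[ℝ] V →L[ℝ] H}
    {σ lam : ℝ} {β : ℕ+ → ℝ} {e : ℕ+ → S.A.domain} {N : ℕ+}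
    (h : IsEigenbasis (S.L lam) β e) (hself : IsSelfAdjoint (S.L lam))
    (henergy : ∀ u : V, inner ℝ (B u u) (S.emb u) = 0)
    (hN : ∀ n : ℕ+, N < n → coef S B e 1 1 n = 0)
    {X : ℝ → Ω → ℝ} {Φ : ℝ → Ω → V} (hsol : SolvesSurrogate S B μ W σ lam β e X Φ)
    {δ X₀ : ℝ} (hδ : 0 < δ) (hβ1 : 0 ≤ β 1) (hβ2 : β 2 ≤ -δ) (hσ : σ ^ 2 / 2 < 2 * β 1 + δ)
    (hX0 : ∀ᵐ ω ∂μ, X 0 ω = X₀)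
    (hΦ0 : ∀ᵐ ω ∂μ, Φ 0 ω = param S B W σ β e N X₀ 0 ω) :
    ∀ᵐ ω ∂μ, ∀ R R' τ : ℝ,
      ∫ s in Iic (0 : ℝ), Real.exp ((2 * β 1 + δ) * s + σ * W s ω) ≤ R' →
      (∀ s ∈ Icc 0 τ, |σ * W s ω| ≤ R) → ∀ t ∈ Icc 0 τ,
      |X t ω| ≤ |X₀| * Real.exp (β 1 * τ + R) ∧
      ‖S.emb (Φ t ω)‖ ≤ Real.exp R * (R' + Real.exp R / δ) * X t ω ^ 2 *
        ‖B (S.inc (e 1)) (S.inc (e 1))‖ := by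
  filter_upwards [hW.ae_continuous, hW.ae_zero, hW.ae_integrableOn_OU, hW.ae_integrableOn hσ,
    hX0, hΦ0, hsol.stable, hsol.mem_domain, hsol.eq_X.continuousOn, hsol.eq_X.deriv,
    hsol.eq_Φ.continuousOn, hsol.eq_Φ.deriv] with ω hc hW0 hOU hi hX0 hΦ0 hst hdom hXc hXd hΦc hΦd
    R R' τ hR' hR t ht
  have hFc : ∀ t, Fc S B e (Φ t ω)
      = -inner ℝ (B (S.inc (e 1)) (S.inc (e 1))) (S.emb (Φ t ω)) :=
    fun t => Fc_eq S B henergy e _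
  have := pathwise_bound (x := fun t => X t ω) (φ := fun t => S.emb (Φ t ω)) h hc hW0 hδ hβ1 hβ2
    (continuousOn_exp_neg_smul hc hOU hXc)
    (fun t ht => by
      have := hasDerivAt_exp_neg_smul hc hOU (hXd t ht)
      rwa [hFc] at this)
    (continuousOn_exp_neg_smul hc hOU hΦc)
    (fun t ht => hasDerivAt_exp_neg_smul hc hOU (hΦd t ht))
    (fun t ht n hn => ?_) hst hi (fun n hn => ?_) hR' hR ht
  · simpa only [hX0] using this
  · have h1n : inner ℝ (e 1 : H) (e n : H) = (0 : ℝ) :=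
      h.orthonormal.2 (by rintro rfl; exact absurd hn (by decide))
    have hmem : S.emb (Φ t ω) ∈ (S.L lam).domain := hdom t ht
    rw [inner_add_left, inner_add_left, inner_projStable h1n, real_inner_smul_left,
      inner_projStable h1n, real_inner_smul_left, evalOp_of_mem hmem,
      h.inner_apply_eigenvector hself, hFc]
  · simp only [hX0]
    rw [hΦ0, inner_emb_param S B W σ β h.orthonormal hN _ _ _ hn, coef]

end Surrogate

end SurrogateSPDE

end

open SurrogateSPDE in
theorem lemma3p1
    {H V Ω : Type*} [NormedAddCommGroup H] [InnerProductSpace ℝ H] [CompleteSpace H]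
    [NormedAddCommGroup V] [NormedSpace ℝ V]
    [MeasurableSpace Ω] (μ : Measure Ω) [IsProbabilityMeasure μ]
    (W : ℝ → Ω → ℝ) (hW : IsTwoSidedBrownian W μ)
    (S : LinearFamily H V) (B : V →L[ℝ] V →L[ℝ] H)
    (lamc lams : ℝ) (β : ℝ → ℕ+ → ℝ) (e : ℝ → ℕ+ → S.A.domain) (N : ℕ+)
    (he : ∀ lam ∈ S.Λ, IsEigenbasis (S.L lam) (β lam) (e lam))
    (hA1 : ∀ lam ∈ S.Λ, IsSelfAdjoint (S.L lam))
    (hA2 : ExchangeOfStabilities S.Λ lamc lams β)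
    (hA3 : NonlinearCondition S B lamc lams e N)
    (hP : ∀ lam ∈ Set.Icc lamc lams,
      Dissipation S B μ W (Real.sqrt (β lam 1)) (β lam) (e lam) N)
    (c T χ : ℝ) (hc : 0 < c) (hT : 0 < T) (hχ : χ ∈ Set.Ioo (0 : ℝ) 1) :
    ∃ C : ℝ, 0 < C ∧
      ∀ lam ∈ Set.Ioc lamc lams, ∀ ε σ : ℝ, ε = β lam 1 → σ = Real.sqrt ε →
      ∀ X₀ : ℝ, |X₀| ≤ c * Real.sqrt ε →
      ∀ (X : ℝ → Ω → ℝ) (Φ : ℝ → Ω → V),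
        SolvesSurrogate S B μ W σ lam (β lam) (e lam) X Φ →
        (∀ᵐ ω ∂μ, X 0 ω = X₀) →
        (∀ᵐ ω ∂μ, Φ 0 ω = param S B W σ (β lam) (e lam) N X₀ 0 ω) →
        1 - χ ≤ μ.real {ω | (∀ t ∈ Set.Icc 0 (T / ε), |X t ω| ≤ C * Real.sqrt ε) ∧
          (∀ t ∈ Set.Icc 0 (T / ε), ‖S.emb (Φ t ω)‖ ≤ C * ε)} := by
  have hpos : ∀ lam ∈ Ioc lamc lams, 0 < β lam 1 := fun lam hl =>
    hA2.pos lam (hA2.subset (Ioc_subset_Icc_self hl)) hl.1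
  -- The endpoint λ_c, where β_1 = 0, is included for the sake of compactness.
  obtain ⟨K, δ, hδ, hK⟩ := exists_critical_mode_bound S β e he hA1 isCompact_Icc hA2.subset
    (fun lam hl => by
      rcases eq_or_lt_of_le hl.1 with h | h
      · rw [← h, hA2.zero]
      · exact (hpos lam ⟨h, hl.2⟩).le)
    (fun lam hl => hA2.stable lam hl 2 le_rfl)
  have hK0 : 0 ≤ K := (norm_nonneg _).trans (hK lamc ⟨le_rfl, hA2.lt.le⟩).1
  have hχ0 : 0 < χ := hχ.1
  obtain ⟨R, hR0, hR⟩ := hW.exists_sup_bound T (η := ENNReal.ofReal (χ / 2))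
    (ENNReal.ofReal_pos.2 (by positivity))
  -- Makes Markov's bound 1/(δR') equal to χ/2, the share of the second bad event.
  set R' : ℝ := 2 / (δ * χ) with hR'
  have hR'0 : 0 < R' := by positivity
  set q : ℝ := c * Real.exp (T + R) with hq
  set KF : ℝ := ‖B‖ * K * K with hKF
  set C₂ : ℝ := Real.exp R * (R' + Real.exp R / δ) * q ^ 2 * KF with hC₂
  have hq0 : 0 < q := by positivity
  have hC₂0 : 0 ≤ C₂ := by positivity
  refine ⟨q + C₂, by positivity, ?_⟩
  rintro lam hlam ε σ hε rfl X₀ hX₀ X Φ hsol hX0 hΦ0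
  have hε0 : 0 < ε := hε ▸ hpos lam hlam
  have hlI := Ioc_subset_Icc_self hlam
  have hlΛ := hA2.subset hlI
  have hsq : Real.sqrt ε ^ 2 = ε := Real.sq_sqrt hε0.le
  have hbad2 := hW.meas_integral_gt_le (r := 2 * ε + δ) (κ := Real.sqrt ε) hδ
    (by rw [hsq]; linarith) hR'0
  have hval : 1 / (δ * R') = χ / 2 := by rw [hR']; field_simp
  rw [hval] at hbad2
  have hbad1 := hR ε hε0
  set G := {ω | (∀ t ∈ Set.Icc 0 (T / ε), |X t ω| ≤ (q + C₂) * Real.sqrt ε) ∧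
          (∀ t ∈ Set.Icc 0 (T / ε), ‖S.emb (Φ t ω)‖ ≤ (q + C₂) * ε)} with hG
  have hae := hsol.ae_bound hW (he lam hlΛ) (hA1 lam hlΛ) hA3.energy (hA3.finite lam hlI)
    hδ (hpos lam hlam).le (hK lam hlI).2 (by rw [hsq]; linarith) hX0 hΦ0
  have hB : ‖B (S.inc (e lam 1)) (S.inc (e lam 1))‖ ≤ KF := by
    refine (B.le_opNorm₂ _ _).trans ?_
    have := (hK lam hlI).1
    rw [hKF]
    gcongr
  have hcompl : μ Gᶜ ≤ ENNReal.ofReal (χ / 2) + ENNReal.ofReal (χ / 2) := by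
    refine le_trans (measure_mono_ae ?_) ((measure_union_le _ _).trans (add_le_add hbad1 hbad2))
    filter_upwards [hae] with ω hω hωG
    by_contra hnot
    have hnot' := not_or.1 hnot
    have hsup : ∀ s ∈ Icc 0 (T / ε), Real.sqrt ε * |W s ω| ≤ R := not_not.1 hnot'.1
    have hint := not_not.1 hnot'.2
    rw [← hε] at hω
    have hb := hω R R' (T / ε) hint fun s hs => by
      rw [abs_mul, abs_of_nonneg (Real.sqrt_nonneg ε)]; exact hsup s hs
    have hXb : ∀ t ∈ Icc 0 (T / ε), |X t ω| ≤ q * Real.sqrt ε := fun t ht => by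
      refine (hb t ht).1.trans ?_
      rw [mul_div_cancel₀ T hε0.ne', hq, mul_right_comm]
      gcongr
    refine hωG ⟨fun t ht => (hXb t ht).trans ?_, fun t ht => (hb t ht).2.trans ?_⟩
    · exact mul_le_mul_of_nonneg_right (by linarith) (Real.sqrt_nonneg ε)
    · have hX2 : X t ω ^ 2 ≤ q ^ 2 * ε := by
        rw [← sq_abs, ← hsq, ← mul_pow]
        exact pow_le_pow_left₀ (abs_nonneg _) (hXb t ht) 2
      calc _ ≤ Real.exp R * (R' + Real.exp R / δ) * (q ^ 2 * ε) * KF := by gcongr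
        _ = C₂ * ε := by rw [hC₂]; ring
        _ ≤ _ := mul_le_mul_of_nonneg_right (by linarith) hε0.le
  have hreal : μ.real Gᶜ ≤ χ := by
    rw [← ENNReal.ofReal_add (by positivity) (by positivity), add_halves] at hcompl
    exact ENNReal.toReal_le_of_le_ofReal hχ0.le hcompl
  -- Subadditivity suffices, so no measurability of `G` is required.
  have huniv : (1 : ℝ) ≤ μ.real G + μ.real Gᶜ := by
    have := measureReal_union_le (μ := μ) G Gᶜ
    rwa [union_compl_self, probReal_univ] at this
  linarith
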